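/- Let $p$ be a prime and let $\mathbf S=\mathbb Z[x]$ be the polynomial ring. For a module $M$ over a commutative ring $R$, let $S(M)$ denote its socle (the submodule generated by all simple submodules), and let $S_0(M)=0$, $S_{m+1}(M)/S_m(M)=S(M/S_m(M))$ be its socle series; $M$ is called cocyclic if $S(M)$ is simple and essential in $M$. For a finitely generated module $M$, let $\operatorname{gen}(M)$ be the smallest number of generators of $M$. For $m\ge 1$ let $P_m$ be the $\mathbf S$-module with additive group $\mathbb Z_{p^m}\times\mathbb Z_{p^{m-1}}\times\dots\times\mathbb Z_p$ and $(xa)(n)=p\,a(n+1)$ for $0\le n\le m-2$, $(xa)(m-1)=0$, where $a=(a(0),\dots,a(m-1))$ and $c\mapsto pc$ is viewed as a homomorphism $\mathbb Z_{p^{m-n-1}}\to\mathbb Z_{p^{m-n}}$. Let $P_{m,1}$ be the $\mathbf S$-module with the same additive group as $P_m$ and the new scalar multiplication $x\cdot a=xa-a$. Thus $P_1$ is $\mathbb Z_p$ with $x\mathbb Z_p=0$, and $P_{1,1}$ is $\mathbb Z_p$ with $x$ acting as $-1$. Let $N=\mathbb Z_{p^\infty}[x^{-1}]$ be the $\mathbf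 S$-module of finitely supported sequences $a:\mathbb N\to\mathbb Z_{p^\infty}$ with $(xa)(n)=a(n+1)$. If $p\neq 2$, then $x$ and $1-x$ act bijectively on $P_{m,1}$, so the scalar multiplication of $P_{m,1}$ extends uniquely to $\mathbf R_2=\mathbb Z[x,x^{-1},(1-x)^{-1}]$; let $P'_{m,1}$ denote the resulting $\mathbf R_2$-module. (1) Let $Q$ be a cocyclic $\mathbf S$-module with $S(Q)\simeq P_1$ and $|Q|=p^6$. Then $Q$ is generated by at most three elements, and if $\operatorname{gen}(Q)=3$ then $Q\simeq P_3\simeq S_3(N)$. (2) Let $Q$ be a cocyclic $\mathbf S$-module with $S(Q)\simeq P_{1,1}$ and $|Q|=p^6$. Then $Q$ is generated by at most three elements, and if $\operatorname{gen}(Q)=3$ then $Q\simeq P_{3,1}$. (3) Let $p\neq 2$ and let $Q$ be a cocyclic $\mathbf R_2$-module with $S(Q)\simeq P'_{1,1}$ and $|Q|=p^6$. Then $Q$ is generated by at most three elements, and if $\operatorname{gen}(Q)=3$ then $Q\simeq P'_{3,1}$. -/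

import Mathlib

open Polynomial

/-- The socle of a module: the submodule generated by all simple (i.e. minimal) submodules. -/
def socle (R M : Type*) [Ring R] [AddCommGroup M] [Module R M] : Submodule R M :=
  sSup {N : Submodule R M | IsSimpleModule R N}

/-- A module is cocyclic if its socle is a simple (in particular non-zero) essential submodule. -/
structure IsCocyclic (R M : Type*) [Ring R] [AddCommGroup M] [Module R M] : Prop where
  simple_socle : IsSimpleModule R (socle R M)
  essential_socle : ∀ N : Submodule R M, N ≠ ⊥ → socle R M ⊓ N ≠ ⊥

/-- The socle series `S_0(M) = 0`, `S_{m+1}(M) / S_m(M) = S(M / S_m(M))`. -/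
def socleSeries (R M : Type*) [Ring R] [AddCommGroup M] [Module R M] : ℕ → Submodule R M
  | 0 => ⊥
  | m + 1 => (socle R (M ⧸ socleSeries R M m)).comap (socleSeries R M m).mkQ

/-- The quasicyclic group `ℤ_{p^∞}`: the `p`-primary component of `ℚ / ℤ`. -/
abbrev Quasicyclic (p : ℕ) [Fact p.Prime] : Type :=
  AddCommGroup.primaryComponent (AddCircle (1 : ℚ)) p

/-- The module of divided powers `M[x⁻¹]` as an `R[x]`-module: finitely supported sequences
`a : ℕ → M`, on which `x` acts as the shift `(x a)(n) = a(n + 1)`. -/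
abbrev DividedPowerModule (R M : Type*) [CommRing R] [AddCommGroup M] [Module R M] : Type _ :=
  Module.AEval' (Finsupp.lcomapDomain Nat.succ Nat.succ_injective : (ℕ →₀ M) →ₗ[R] (ℕ →₀ M))

/-- The formula `(f a)(n) = ∑ i, f_i a(n + i)` for the action of polynomials. -/
theorem DividedPowerModule.smul_apply {R M : Type*} [CommRing R] [AddCommGroup M] [Module R M]
    (f : R[X]) (a : ℕ →₀ M) (n : ℕ) :
    (Module.AEval'.of (Finsupp.lcomapDomain Nat.succ Nat.succ_injective :
        (ℕ →₀ M) →ₗ[R] (ℕ →₀ M))).symm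
      (f • Module.AEval'.of (Finsupp.lcomapDomain Nat.succ Nat.succ_injective :
        (ℕ →₀ M) →ₗ[R] (ℕ →₀ M)) a) n = f.sum fun i r => r • a (n + i) := by
  rw [← Module.AEval.of_aeval_smul, LinearEquiv.symm_apply_apply, aeval_eq_sum_range,
    Polynomial.sum_over_range _ (by simp)]
  have key : ∀ (i : ℕ) (b : ℕ →₀ M) (k : ℕ),
      (((Finsupp.lcomapDomain Nat.succ Nat.succ_injective :
        (ℕ →₀ M) →ₗ[R] (ℕ →₀ M)) ^ i) b) k = b (k + i) := by
    intro i
    induction i with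
    | zero => intro b k; simp
    | succ i ih =>
      intro b k
      rw [pow_succ, Module.End.mul_apply, ih]
      simp [Finsupp.lcomapDomain, Finsupp.comapDomain_apply, add_assoc]
  simp [key, LinearMap.sum_apply, Finsupp.finsetSum_apply]

/-- The additive group `ℤ_{p^m} × ℤ_{p^{m-1}} × ⋯ × ℤ_p`. -/
abbrev PGroup (p m : ℕ) : Type := (n : Fin m) → ZMod (p ^ (m - (n : ℕ)))

/-- The homomorphism `ℤ_{p^j} → ℤ_{p^k}`, `c ↦ p c`, where `k ≤ j + 1`. -/
def mulP (p : ℕ) {j k : ℕ} (h : k ≤ j + 1) : ZMod (p ^ j) →+ ZMod (p ^ k) :=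
  ZMod.lift (p ^ j) ⟨zmultiplesHom (ZMod (p ^ k)) (p : ZMod (p ^ k)), by
    have : ((p ^ (j + 1) : ℕ) : ZMod (p ^ k)) = 0 :=
      (ZMod.natCast_eq_zero_iff _ _).2 (pow_dvd_pow p h)
    simpa [pow_succ] using this⟩

theorem mulP_intCast (p : ℕ) {j k : ℕ} (h : k ≤ j + 1) (c : ℤ) :
    mulP p h (c : ZMod (p ^ j)) = (p : ZMod (p ^ k)) * c := by
  simp [mulP, mul_comm]

/-- The endomorphism `(σ a)(n) = p a(n + 1)` for `n + 1 < m`, `(σ a)(m - 1) = 0`. -/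
def shiftP (p m : ℕ) : Module.End ℤ (PGroup p m) :=
  AddMonoidHom.toIntLinearMap
    { toFun := fun a n =>
        if h : (n : ℕ) + 1 < m then
          mulP p (show m - (n : ℕ) ≤ (m - ((n : ℕ) + 1)) + 1 by omega) (a ⟨(n : ℕ) + 1, h⟩)
        else 0
      map_zero' := by
        funext n
        by_cases h : (n : ℕ) + 1 < m <;> simp [h]
      map_add' := fun a b => by
        funext n
        by_cases h : (n : ℕ) + 1 < m <;> simp [h] }

/-- The `ℤ[x]`-module `P_m`: the group `ℤ_{p^m} × ⋯ × ℤ_p` with `(x a)(n) = p a(n + 1)` for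
`n + 1 < m` and `(x a)(m - 1) = 0`. -/
abbrev PMod (p m : ℕ) : Type := Module.AEval' (shiftP p m)

/-- The `ℤ[x]`-module `P_{m,1}`: the group `P_m` with the new action `x · a = x a - a`. -/
abbrev PShift (p m : ℕ) : Type := Module.AEval' (shiftP p m - 1)

/-- The ring `ℤ[x, x⁻¹, (1 - x)⁻¹]`. -/
abbrev R₂ : Type := Localization.Away (X * (1 - X) : ℤ[X])

theorem shiftP_pow_apply_eq_zero (p m k : ℕ) (a : PGroup p m) (n : Fin m)
    (h : m ≤ (n : ℕ) + k) : ((shiftP p m) ^ k) a n = 0 := by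
  induction k generalizing a n with
  | zero => omega
  | succ k ih =>
    rw [pow_succ', Module.End.mul_apply]
    by_cases h1 : (n : ℕ) + 1 < m
    · have := ih a ⟨(n : ℕ) + 1, h1⟩ (by simp; omega)
      have e : ∀ b : PGroup p m, shiftP p m b n =
          mulP p (show m - (n : ℕ) ≤ (m - ((n : ℕ) + 1)) + 1 by omega) (b ⟨(n : ℕ) + 1, h1⟩) :=
        fun b => by simp [shiftP, h1]
      rw [e, this, map_zero]
    · simp [shiftP, h1]

theorem isNilpotent_shiftP (p m : ℕ) : IsNilpotent (shiftP p m) := by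
  refine ⟨m, LinearMap.ext fun a => funext fun n => ?_⟩
  simpa using shiftP_pow_apply_eq_zero p m m a n (by omega)

theorem isUnit_two_end (p m : ℕ) [hp : Fact p.Prime] (h2 : p ≠ 2) :
    IsUnit (2 : Module.End ℤ (PGroup p m)) := by
  have h0 : ((p ^ m : ℤ) : Module.End ℤ (PGroup p m)) = 0 := by
    refine LinearMap.ext fun a => funext fun n => ?_
    have : ((p ^ m : ℕ) : ZMod (p ^ (m - (n : ℕ)))) = 0 :=
      (ZMod.natCast_eq_zero_iff _ _).2 (pow_dvd_pow p (by omega))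
    have h3 : ((p ^ m : ℤ) : Module.End ℤ (PGroup p m)) a = (p ^ m : ℤ) • a := by
      have := Module.End.intCast_apply (R := ℤ) (N₁ := PGroup p m) ((p : ℤ) ^ m) a
      simpa only [Int.cast_pow, Int.cast_natCast] using this
    rw [h3]
    simp only [Pi.smul_apply, zsmul_eq_mul, LinearMap.zero_apply, Pi.zero_apply]
    push_cast at this ⊢
    rw [this, zero_mul]
  have hc : IsCoprime (2 : ℤ) ((p : ℤ) ^ m) := by
    have : Nat.Coprime 2 p := (Nat.coprime_primes Nat.prime_two hp.out).2 (Ne.symm h2)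
    exact (Nat.isCoprime_iff_coprime.2 this).pow_right
  obtain ⟨u, v, huv⟩ := hc
  have e : (u : Module.End ℤ (PGroup p m)) * 2 = 1 := by
    have := congrArg (fun z : ℤ => (z : Module.End ℤ (PGroup p m))) huv
    simp only [Int.cast_add, Int.cast_mul, h0, mul_zero, add_zero, Int.cast_one,
      Int.cast_ofNat] at this
    exact this
  have e' : 2 * (u : Module.End ℤ (PGroup p m)) = 1 := by
    rw [← e]; exact (Int.cast_commute u (2 : Module.End ℤ (PGroup p m))).eq.symm
  exact ⟨⟨2, u, e', e⟩, rfl⟩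

/-- For odd `p`, both `x` and `1 - x` act bijectively on `P_{m,1}`. -/
theorem isUnit_aeval_shift (p m : ℕ) [Fact p.Prime] (h2 : p ≠ 2)
    (s : Submonoid.powers (X * (1 - X) : ℤ[X])) :
    IsUnit (aeval (shiftP p m - 1) (s : ℤ[X])) := by
  obtain ⟨_, k, rfl⟩ := s
  have hσ := isNilpotent_shiftP p m
  have h1 : IsUnit (shiftP p m - 1) := by
    simpa using hσ.isUnit_one_sub.neg
  have h3 : IsUnit (1 - (shiftP p m - 1)) := by
    have := hσ.neg.isUnit_add_left_of_commute (isUnit_two_end p m h2)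
      ((Commute.ofNat_right (shiftP p m) 2).neg_left)
    have e : (1 : Module.End ℤ (PGroup p m)) - (shiftP p m - 1) = 2 + -shiftP p m := by
      rw [← one_add_one_eq_two]; abel
    rw [e]; exact this
  simpa using (h1.mul h3).pow k

/-- The `ℤ[x, x⁻¹, (1 - x)⁻¹]`-module `P'_{m,1}` for a prime `p ≠ 2`: the group `P_{m,1}` with
the unique extension of its `ℤ[x]`-scalar multiplication. -/
def PShift' (p m : ℕ) [Fact p.Prime] (_h2 : p ≠ 2) : Type := PGroup p m

instance (p m : ℕ) [Fact p.Prime] (h2 : p ≠ 2) : AddCommGroup (PShift' p m h2) :=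
  inferInstanceAs (AddCommGroup (PGroup p m))

/-- The identity map from the additive group of `P_m` to that of `P'_{m,1}`. -/
def PShift'.of (p m : ℕ) [Fact p.Prime] (h2 : p ≠ 2) : PGroup p m ≃+ PShift' p m h2 :=
  AddEquiv.refl _

/-- The ring homomorphism `ℤ[x, x⁻¹, (1 - x)⁻¹] → End(P_m)` sending `x` to `σ - 1`. -/
noncomputable def actionPShift' (p m : ℕ) [Fact p.Prime] (h2 : p ≠ 2) :
    R₂ →+* Module.End ℤ (PGroup p m) :=
  OreLocalization.universalHom (aeval (shiftP p m - 1)).toRingHom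
    (IsUnit.liftRight
      ((aeval (shiftP p m - 1) : ℤ[X] →ₐ[ℤ] Module.End ℤ (PGroup p m)).toRingHom.toMonoidHom.comp
        (Submonoid.powers (X * (1 - X) : ℤ[X])).subtype) (isUnit_aeval_shift p m h2))
    (fun _ => rfl)

noncomputable instance (p m : ℕ) [Fact p.Prime] (h2 : p ≠ 2) : Module R₂ (PShift' p m h2) :=
  Module.compHom (PGroup p m) (actionPShift' p m h2)

/-- The scalar multiplication of `P'_{m,1}` extends that of `P_{m,1}`. -/
theorem PShift'.algebraMap_smul (p m : ℕ) [Fact p.Prime] (h2 : p ≠ 2) (f : ℤ[X])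
    (a : PGroup p m) :
    (PShift'.of p m h2).symm (algebraMap ℤ[X] R₂ f • PShift'.of p m h2 a) =
      (Module.AEval'.of (shiftP p m - 1)).symm (f • Module.AEval'.of (shiftP p m - 1) a) := by
  rw [← Module.AEval.of_aeval_smul, LinearEquiv.symm_apply_apply]
  change actionPShift' p m h2 (algebraMap ℤ[X] R₂ f) a = _
  have : actionPShift' p m h2 (algebraMap ℤ[X] R₂ f) = aeval (shiftP p m - 1) f :=
    OreLocalization.universalHom_commutes _ _ _
  rw [this]
  rfl

/-! Let `m` be the annihilator of the simple socle. In all three cases it is generated by two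
elements, `p` and `y`, with residue field of order `p`; here `y` is `x` or `x + 1`, and it acts on
the model module as the shift. Put `A = R / Ann(Q)`.

Duality. A complex character of `Q` that is nontrivial on the socle is trivial on no nonzero
submodule, so `(a, q) ↦ ψ (a • q)` is a perfect pairing of `A` with `Q`. Hence `|A| = |Q| = p ^ 6`,
and `Q` is the character dual of `A`. Characters of `Q / mQ` come from scalars that kill `m`, so the
number of generators of `Q` is controlled by `|Ann_A(m)|` (`IsSeparating.natCard_quotient_le`
together with Nakayama).

Counting. Some power of `m` kills `Q`, so `m` is nilpotent in `A`. If `|Ann_A(m)| > p ^ 2`, then `m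
/ m ^ 2` has dimension two and `Ann_A(m) ≤ m ^ 2`. As `|m ^ 2| ≤ p ^ 3`, the two ideals coincide, so
`|Ann_A(m)| = p ^ 3` and `m ^ 3 = 0` (`HasPrimeResidue.annihilator_bound`). Thus three generators
suffice, and if three are needed then `m ^ 3` kills `Q`.

Uniqueness. Since `|R / m ^ 3| ≤ p ^ 6`, a cocyclic module of order `p ^ 6` killed by `m ^ 3` is the
full dual of `R / m ^ 3`, which determines it up to isomorphism. The modules `P_3`, `P_{3,1}` and
`P'_{3,1}` have these properties. Finally, dividing the coordinate `a(n)` by `p ^ (m - n)` embeds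
`P_m` into `N` with image the elements killed by the `m`-th power of `(p, x)`, which is `S_m(N)`. -/

/-! ### Ideals with residue field of order `p` -/

/-- The proper ideal `m` contains the prime `p`, and every element is congruent modulo `m` to one
of `0, …, p - 1`; so the residue ring is the field with `p` elements. -/
structure HasPrimeResidue {R : Type*} [CommRing R] (p : ℕ) (m : Ideal R) : Prop where
  prime : p.Prime
  natCast_mem : (p : R) ∈ m
  exists_sub_mem : ∀ a : R, ∃ c : ℕ, c < p ∧ a - c ∈ m
  ne_top : m ≠ ⊤

namespace HasPrimeResidue

variable {R : Type*} [CommRing R] {p : ℕ} {m : Ideal R}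

theorem natCast_mem_iff (h : HasPrimeResidue p m) (c : ℕ) : (c : R) ∈ m ↔ p ∣ c := by
  refine ⟨fun hc => ?_, fun ⟨d, hd⟩ => ?_⟩
  · by_contra hpc
    have hco : IsCoprime (p : ℤ) (c : ℤ) :=
      Nat.isCoprime_iff_coprime.2 ((h.prime.coprime_iff_not_dvd).2 hpc)
    obtain ⟨a, b, hab⟩ := hco
    refine h.ne_top ((Ideal.eq_top_iff_one m).2 ?_)
    have : (1 : R) = (a : R) * (p : R) + (b : R) * (c : R) := by
      have := congrArg (fun z : ℤ => (z : R)) hab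
      push_cast at this
      exact this.symm
    rw [this]
    exact m.add_mem (m.mul_mem_left _ h.natCast_mem) (m.mul_mem_left _ hc)
  · rw [hd, Nat.cast_mul]
    exact m.mul_mem_right _ h.natCast_mem

theorem eq_of_natCast_sub_mem (h : HasPrimeResidue p m) {c d : ℕ} (hc : c < p) (hd : d < p)
    (hcd : (c : R) - d ∈ m) : c = d := by
  wlog hle : d ≤ c generalizing c d
  · exact (this hd hc (by simpa using m.neg_mem hcd) (le_of_not_ge hle)).symm
  rw [← Nat.cast_sub hle, h.natCast_mem_iff] at hcd
  have := Nat.eq_zero_of_dvd_of_lt hcd (by omega)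
  omega

theorem isMaximal (h : HasPrimeResidue p m) : m.IsMaximal := by
  refine Ideal.isMaximal_iff.2 ⟨(Ideal.ne_top_iff_one m).1 h.ne_top, fun J a hmJ ham haJ => ?_⟩
  obtain ⟨c, hc, hac⟩ := h.exists_sub_mem a
  have hcJ : (c : R) ∈ J := by simpa using J.sub_mem haJ (hmJ hac)
  have hcm : (c : R) ∉ m := fun hcm => ham (by simpa using m.add_mem hac hcm)
  rw [h.natCast_mem_iff] at hcm
  have hco : IsCoprime (p : ℤ) (c : ℤ) :=
    Nat.isCoprime_iff_coprime.2 ((h.prime.coprime_iff_not_dvd).2 hcm)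
  obtain ⟨a, b, hab⟩ := hco
  have : (1 : R) = (a : R) * (p : R) + (b : R) * (c : R) := by
    have := congrArg (fun z : ℤ => (z : R)) hab
    push_cast at this
    exact this.symm
  rw [this]
  exact J.add_mem (J.mul_mem_left _ (hmJ h.natCast_mem)) (J.mul_mem_left _ hcJ)

theorem natCard_quotient (h : HasPrimeResidue p m) : Nat.card (R ⧸ m) = p := by
  have : Function.Bijective (fun c : Fin p => Ideal.Quotient.mk m ((c : ℕ) : R)) := by
    constructor
    · intro c d hcd
      exact Fin.ext (h.eq_of_natCast_sub_mem c.2 d.2 (Ideal.Quotient.eq.1 hcd))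
    · intro a
      obtain ⟨a, rfl⟩ := Ideal.Quotient.mk_surjective a
      obtain ⟨c, hc, hac⟩ := h.exists_sub_mem a
      exact ⟨⟨c, hc⟩, (Ideal.Quotient.eq.2 hac).symm⟩
  rw [← Nat.card_eq_of_bijective _ this, Nat.card_fin]

theorem isUnit_of_notMem (h : HasPrimeResidue p m) (hnil : IsNilpotent m) {a : R} (ha : a ∉ m) :
    IsUnit a := by
  have := h.isMaximal
  obtain ⟨b, hb⟩ := this.exists_inv ha
  obtain ⟨i, hi, hbi⟩ := hb
  obtain ⟨k, hk⟩ := hnil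
  have hin : IsNilpotent i := ⟨k, by simpa [hk] using Ideal.pow_mem_pow hi k⟩
  have : IsUnit (b * a) := by
    rw [show b * a = 1 - i by rw [← hbi]; ring]
    exact hin.isUnit_one_sub
  exact isUnit_of_mul_isUnit_right this

/-- Every element has an expansion up to first order in the generators of `m`. -/
theorem exists_sub_mem_sq (h : HasPrimeResidue p m) {u v : R} (hm : m = Ideal.span {u, v})
    (a : R) : ∃ c d e : ℕ, c < p ∧ d < p ∧ e < p ∧ a - (c + d * u + e * v) ∈ m ^ 2 := by
  obtain ⟨c, hc, hac⟩ := h.exists_sub_mem a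
  have hac' := hac
  rw [hm, Ideal.mem_span_pair] at hac'
  obtain ⟨b₁, b₂, hb⟩ := hac'
  obtain ⟨d, hd, hbd⟩ := h.exists_sub_mem b₁
  obtain ⟨e, he, hbe⟩ := h.exists_sub_mem b₂
  have hu : u ∈ m := hm ▸ Ideal.subset_span (by simp)
  have hv : v ∈ m := hm ▸ Ideal.subset_span (by simp)
  refine ⟨c, d, e, hc, hd, he, ?_⟩
  rw [show a - (c + d * u + e * v) = (b₁ - d) * u + (b₂ - e) * v by linear_combination -hb, pow_two]
  exact add_mem (Ideal.mul_mem_mul hbd hu) (Ideal.mul_mem_mul hbe hv)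

/-- The six monomials of degree at most two in `u, v` are the source of the exponent in `p ^ 6`. -/
theorem exists_sub_mem_cube (h : HasPrimeResidue p m) {u v : R} (hm : m = Ideal.span {u, v})
    (a : R) : ∃ c : Fin 6 → Fin p, a - ((c 0 : ℕ) + (c 1 : ℕ) * u + (c 2 : ℕ) * v +
      (c 3 : ℕ) * u ^ 2 + (c 4 : ℕ) * (u * v) + (c 5 : ℕ) * v ^ 2) ∈ m ^ 3 := by
  obtain ⟨c, hc, hac⟩ := h.exists_sub_mem a
  have hac' := hac
  rw [hm, Ideal.mem_span_pair] at hac'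
  obtain ⟨b₁, b₂, hb⟩ := hac'
  obtain ⟨d₀, d₁, d₂, h₀, h₁, h₂, hd⟩ := h.exists_sub_mem_sq hm b₁
  obtain ⟨e₀, hE, hbe⟩ := h.exists_sub_mem b₂
  have hbe' := hbe
  rw [hm, Ideal.mem_span_pair] at hbe'
  obtain ⟨f₁, f₂, hf⟩ := hbe'
  have hu : u ∈ m := hm ▸ Ideal.subset_span (by simp)
  have hv : v ∈ m := hm ▸ Ideal.subset_span (by simp)
  -- The monomial `u * v` arises twice, from `b₁ * u` and from `b₂ * v`; both coefficients are
  -- reduced together.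
  obtain ⟨g, hg, hfg⟩ := h.exists_sub_mem (f₁ + d₂)
  obtain ⟨k, hk, hfk⟩ := h.exists_sub_mem f₂
  refine ⟨![⟨c, hc⟩, ⟨d₀, h₀⟩, ⟨e₀, hE⟩, ⟨d₁, h₁⟩, ⟨g, hg⟩, ⟨k, hk⟩], ?_⟩
  have key : a - (c + d₀ * u + e₀ * v + d₁ * u ^ 2 + g * (u * v) + k * v ^ 2) =
      (b₁ - (d₀ + d₁ * u + d₂ * v)) * u + (f₁ + d₂ - g) * (u * v) + (f₂ - k) * (v * v) := by
    linear_combination -hb - v * hf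
  have h3 : m ^ 3 = m ^ 2 * m := pow_succ m 2
  have h3' : m ^ 3 = m * (m * m) := by rw [pow_succ', pow_two]
  change a - (c + d₀ * u + e₀ * v + d₁ * u ^ 2 + g * (u * v) + k * v ^ 2) ∈ m ^ 3
  rw [key]
  refine add_mem (add_mem (h3 ▸ Ideal.mul_mem_mul hd hu) ?_) ?_
  · exact h3' ▸ Ideal.mul_mem_mul hfg (Ideal.mul_mem_mul hu hv)
  · exact h3' ▸ Ideal.mul_mem_mul hfk (Ideal.mul_mem_mul hv hv)

theorem natCard_quotient_cube_le (h : HasPrimeResidue p m) {u v : R}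
    (hm : m = Ideal.span {u, v}) : Finite (R ⧸ m ^ 3) ∧ Nat.card (R ⧸ m ^ 3) ≤ p ^ 6 := by
  have hs : Function.Surjective (fun c : Fin 6 → Fin p => Ideal.Quotient.mk (m ^ 3)
      ((c 0 : ℕ) + (c 1 : ℕ) * u + (c 2 : ℕ) * v +
      (c 3 : ℕ) * u ^ 2 + (c 4 : ℕ) * (u * v) + (c 5 : ℕ) * v ^ 2)) := by
    intro a
    obtain ⟨a, rfl⟩ := Ideal.Quotient.mk_surjective a
    obtain ⟨c, hc⟩ := h.exists_sub_mem_cube hm a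
    exact ⟨c, (Ideal.Quotient.eq.2 hc).symm⟩
  refine ⟨Finite.of_surjective _ hs, ?_⟩
  simpa [Nat.card_eq_fintype_card] using Nat.card_le_card_of_surjective _ hs

/-- If no nontrivial linear combination of the generators of `m` lies in `m ^ 2`, then `m / m ^ 2`
has dimension two. -/
theorem pow_three_le_natCard [Finite R] (h : HasPrimeResidue p m) {u v : R}
    (hm : m = Ideal.span {u, v}) (huv : ∀ a b : R, a * u + b * v ∈ m ^ 2 → a ∈ m ∧ b ∈ m) :
    p ^ 3 ≤ Nat.card (R ⧸ m ^ 2) := by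
  have hu : u ∈ m := hm ▸ Ideal.subset_span (by simp)
  have hv : v ∈ m := hm ▸ Ideal.subset_span (by simp)
  have hi : Function.Injective (fun c : Fin 3 → Fin p => Ideal.Quotient.mk (m ^ 2)
      ((c 0 : ℕ) + (c 1 : ℕ) * u + (c 2 : ℕ) * v)) := by
    intro c d hcd
    replace hcd := Ideal.Quotient.eq.1 hcd
    have h0 : c 0 = d 0 := by
      refine Fin.ext (h.eq_of_natCast_sub_mem (c 0).2 (d 0).2 ?_)
      have h1 := Ideal.pow_le_self two_ne_zero hcd
      have h2 := m.sub_mem h1 (m.add_mem (m.mul_mem_left ((c 1 : ℕ) - (d 1 : ℕ) : R) hu)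
        (m.mul_mem_left ((c 2 : ℕ) - (d 2 : ℕ) : R) hv))
      convert h2 using 1
      ring
    have h12 := huv ((c 1 : ℕ) - (d 1 : ℕ)) ((c 2 : ℕ) - (d 2 : ℕ)) (by
      convert hcd using 1
      rw [h0]
      ring)
    have h1 := Fin.ext (h.eq_of_natCast_sub_mem (c 1).2 (d 1).2 h12.1)
    have h2 := Fin.ext (h.eq_of_natCast_sub_mem (c 2).2 (d 2).2 h12.2)
    funext i
    fin_cases i <;> assumption
  have : Finite (R ⧸ m ^ 2) := Finite.of_surjective _ Ideal.Quotient.mk_surjective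
  simpa [Nat.card_eq_fintype_card] using Nat.card_le_card_of_injective _ hi

end HasPrimeResidue

/-! ### The annihilator of the maximal ideal in a finite ring -/

/-- Kernel and cokernel of an endomorphism of a finite group have the same order. -/
theorem natCard_ker_mulLeft {A : Type*} [CommRing A] [Finite A] (w : A) :
    Nat.card (LinearMap.ker (LinearMap.mulLeft A w)) = Nat.card (A ⧸ Ideal.span {w}) := by
  set f := LinearMap.mulLeft A w
  have hr : LinearMap.range f = Ideal.span {w} := by
    ext a
    simp only [LinearMap.mem_range, f, LinearMap.mulLeft_apply, Ideal.mem_span_singleton]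
    exact ⟨fun ⟨b, hb⟩ => ⟨b, hb.symm⟩, fun ⟨b, hb⟩ => ⟨b, hb.symm⟩⟩
  have h1 := Submodule.card_eq_card_quotient_mul_card (LinearMap.ker f)
  have h2 := Submodule.card_eq_card_quotient_mul_card (LinearMap.range f)
  rw [Nat.card_congr f.quotKerEquivRange.toEquiv] at h1
  rw [h1, hr, mul_comm] at h2
  exact Nat.eq_of_mul_eq_mul_left Nat.card_pos h2

theorem natCard_annihilator_le {A : Type*} [CommRing A] [Finite A] {m : Ideal A} {w : A}
    (hw : w ∈ m) : Nat.card m.annihilator ≤ Nat.card (A ⧸ Ideal.span {w}) := by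
  rw [← natCard_ker_mulLeft]
  refine Nat.card_mono (Set.toFinite _) fun a ha => ?_
  have := Submodule.mem_annihilator.1 ha w hw
  simpa [mul_comm] using this

namespace HasPrimeResidue

variable {A : Type*} [CommRing A] [Finite A] {p : ℕ} {m : Ideal A}

theorem natCard_annihilator_le_of_principal (h : HasPrimeResidue p m) {w : A}
    (hm : m = Ideal.span {w}) : Nat.card m.annihilator ≤ p := by
  have := natCard_annihilator_le (m := m) (w := w) (hm ▸ Ideal.mem_span_singleton_self w)
  rwa [← hm, h.natCard_quotient] at this

/-- Modulo `w` every element is `c + b * l`, and since `l` kills `m` only the residue of `b`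
matters. So `A / (w)` has at most `p * p` elements. -/
theorem natCard_annihilator_le_sq (h : HasPrimeResidue p m) {l w : A}
    (hm : m = Ideal.span {l, w}) (hl : l ∈ m.annihilator) :
    Nat.card m.annihilator ≤ p ^ 2 := by
  refine (natCard_annihilator_le (w := w) (hm ▸ Ideal.subset_span (by simp))).trans ?_
  have hs : Function.Surjective (fun c : Fin p × Fin p => Ideal.Quotient.mk (Ideal.span {w})
      ((c.1 : ℕ) + (c.2 : ℕ) * l)) := by
    intro a
    obtain ⟨a, rfl⟩ := Ideal.Quotient.mk_surjective a
    obtain ⟨c, hc, hac⟩ := h.exists_sub_mem a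
    rw [hm, Ideal.mem_span_pair] at hac
    obtain ⟨b₁, b₂, hb⟩ := hac
    obtain ⟨d, hd, hbd⟩ := h.exists_sub_mem b₁
    have h0 : l * (b₁ - d) = 0 := Submodule.mem_annihilator.1 hl _ hbd
    refine ⟨(⟨c, hc⟩, ⟨d, hd⟩), (Ideal.Quotient.eq.2 ?_).symm⟩
    refine Ideal.mem_span_singleton.2 ⟨b₂, ?_⟩
    dsimp only
    linear_combination -hb + h0
  simpa [Nat.card_eq_fintype_card, pow_two] using Nat.card_le_card_of_surjective _ hs

theorem span_pair_of_unit {R : Type*} [CommRing R] {u v a b l : R} (ha : IsUnit a)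
    (hl : l = a * u + b * v) : Ideal.span {u, v} = Ideal.span {l, v} := by
  obtain ⟨a, rfl⟩ := ha
  apply le_antisymm <;> rw [Ideal.span_le, Set.insert_subset_iff, Set.singleton_subset_iff]
  · refine ⟨Ideal.mem_span_pair.2 ⟨(a⁻¹ : Rˣ), -(a⁻¹ : Rˣ) * b, ?_⟩, Ideal.subset_span (by simp)⟩
    rw [hl]
    linear_combination u * a.inv_mul
  · exact ⟨Ideal.mem_span_pair.2 ⟨a, b, hl.symm⟩, Ideal.subset_span (by simp)⟩

omit [Finite A] in
-- A coefficient outside the nilpotent ideal `m` is a unit, so the combination can replace the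
-- corresponding generator.
theorem exists_span_pair (h : HasPrimeResidue p m) (hnil : IsNilpotent m) {u v : A}
    (hm : m = Ideal.span {u, v}) {a b : A} (hab : a ∉ m ∨ b ∉ m) :
    ∃ w, m = Ideal.span {a * u + b * v, w} := by
  rcases hab with ha | hb
  · exact ⟨v, hm.trans (span_pair_of_unit (h.isUnit_of_notMem hnil ha) rfl)⟩
  · refine ⟨u, hm.trans ?_⟩
    rw [Set.pair_comm]
    exact span_pair_of_unit (h.isUnit_of_notMem hnil hb) (add_comm _ _)

theorem annihilator_bound (h : HasPrimeResidue p m) (hnil : IsNilpotent m) {u v : A}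
    (hm : m = Ideal.span {u, v}) (hA : Nat.card A = p ^ 6) :
    Nat.card m.annihilator ≤ p ^ 3 ∧ (p ^ 2 < Nat.card m.annihilator → m ^ 3 = ⊥) := by
  have hp1 : 1 ≤ p := h.prime.one_le
  suffices hs : p ^ 2 < Nat.card m.annihilator → Nat.card m.annihilator ≤ p ^ 3 ∧ m ^ 3 = ⊥ by
    refine ⟨?_, fun h2 => (hs h2).2⟩
    by_contra hlt
    exact hlt (hs (lt_of_le_of_lt (Nat.pow_le_pow_right hp1 (by norm_num)) (not_le.1 hlt))).1
  intro h2
  -- An annihilating element outside `m ^ 2` would be one of two generators of `m`, which forces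
  -- `|Ann(m)| ≤ p ^ 2`.
  have hle : m.annihilator ≤ m ^ 2 := by
    intro l hl
    by_contra hl2
    have hlm : l ∈ m := by
      by_contra hlm
      have h0 : m = ⊥ := by
        refine (Submodule.eq_bot_iff _).2 fun x hx => ?_
        exact (h.isUnit_of_notMem hnil hlm).mul_right_eq_zero.1 (Submodule.mem_annihilator.1 hl x hx)
      have := h.natCard_quotient
      rw [h0, Nat.card_congr (RingEquiv.quotientBot A).toEquiv, hA] at this
      have := Nat.pow_lt_pow_right h.prime.one_lt (show 1 < 6 by norm_num)
      rw [pow_one] at this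
      omega
    have hlm' := hlm
    rw [hm, Ideal.mem_span_pair] at hlm'
    obtain ⟨a, b, rfl⟩ := hlm'
    have hab : a ∉ m ∨ b ∉ m := by
      by_contra! hab
      refine hl2 ?_
      rw [pow_two]
      exact add_mem (Ideal.mul_mem_mul hab.1 (hm ▸ Ideal.subset_span (by simp)))
        (Ideal.mul_mem_mul hab.2 (hm ▸ Ideal.subset_span (by simp)))
    obtain ⟨w, hw⟩ := h.exists_span_pair hnil hm hab
    exact absurd (h.natCard_annihilator_le_sq hw hl) (not_le.2 h2)
  -- Otherwise a generator is redundant modulo `m ^ 2`; then `m` is principal and `|Ann(m)| ≤ p`.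
  have h3 : p ^ 3 ≤ Nat.card (A ⧸ m ^ 2) := by
    refine h.pow_three_le_natCard hm fun a b hab2 => ?_
    by_contra hab
    obtain ⟨w, hw⟩ := h.exists_span_pair hnil hm (a := a) (b := b) (by tauto)
    have hmw : m = Ideal.span {w} := by
      refine le_antisymm ?_ ((Ideal.span_singleton_le_iff_mem _).2 (hw ▸ Ideal.subset_span (by simp)))
      -- Nakayama by iteration: the error term moves into ever higher powers of the nilpotent ideal
      -- `m`.
      have hstep : ∀ k, m ≤ Ideal.span {w} ⊔ m ^ (k + 1) := by
        intro k
        induction k with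
        | zero => simp
        | succ k ih =>
          have h1 : m ≤ Ideal.span {w} ⊔ m ^ 2 := by
            conv_lhs => rw [hw]
            rw [Ideal.span_le, Set.insert_subset_iff, Set.singleton_subset_iff]
            exact ⟨Ideal.mem_sup_right hab2, Ideal.mem_sup_left (Ideal.mem_span_singleton_self w)⟩
          refine h1.trans (sup_le le_sup_left ?_)
          calc m ^ 2 = m * m := pow_two m
            _ ≤ m * (Ideal.span {w} ⊔ m ^ (k + 1)) := Ideal.mul_mono_right ih
            _ = m * Ideal.span {w} ⊔ m ^ (k + 1 + 1) := by rw [Ideal.mul_sup, pow_succ' m (k + 1)]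
            _ ≤ _ := sup_le_sup_right Ideal.mul_le_right _
      obtain ⟨k, hk⟩ := hnil
      have := hstep k
      rwa [pow_succ, hk, zero_mul, Ideal.zero_eq_bot, sup_bot_eq] at this
    have := h.natCard_annihilator_le_of_principal hmw
    have := Nat.pow_le_pow_right hp1 (show 1 ≤ 2 by norm_num)
    rw [pow_one] at this
    omega
  have hcard := Submodule.card_eq_card_quotient_mul_card (m ^ 2)
  rw [hA] at hcard
  have hm2 : Nat.card ↥(m ^ 2) ≤ p ^ 3 := by
    have h4 : p ^ 3 * Nat.card ↥(m ^ 2) ≤ p ^ 3 * p ^ 3 := by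
      rw [← pow_add, hcard]
      rw [mul_comm]
      exact Nat.mul_le_mul_left _ h3
    exact Nat.le_of_mul_le_mul_left h4 (by positivity)
  have hann : Nat.card m.annihilator ≤ Nat.card ↥(m ^ 2) := Nat.card_mono (Set.toFinite _) hle
  refine ⟨hann.trans hm2, ?_⟩
  -- The order is a power of `p` larger than `p ^ 2`, hence at least `p ^ 3`, and the inclusion into
  -- `m ^ 2` is an equality by counting.
  have hdvd : Nat.card m.annihilator ∣ p ^ 6 := by
    rw [← hA, Submodule.card_eq_card_quotient_mul_card m.annihilator]
    exact dvd_mul_right _ _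
  obtain ⟨j, -, hj⟩ := (Nat.dvd_prime_pow h.prime).1 hdvd
  have hj3 : 3 ≤ j := by
    rw [hj] at h2
    exact (Nat.pow_lt_pow_iff_right h.prime.one_lt).1 h2
  have heq : m ^ 2 ≤ m.annihilator := by
    have hc : Nat.card ↥(m ^ 2) ≤ Nat.card m.annihilator := by
      rw [hj]
      exact hm2.trans (Nat.pow_le_pow_right hp1 hj3)
    have := Set.eq_of_subset_of_ncard_le (s := (m.annihilator : Set A)) (t := ((m ^ 2 : Ideal A) : Set A))
      hle hc (Set.toFinite _)
    exact fun x hx => (this ▸ hx : x ∈ (m.annihilator : Set A))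
  rw [pow_succ, eq_bot_iff]
  exact (Ideal.mul_mono_left heq).trans (by rw [Submodule.annihilator_mul])

end HasPrimeResidue

/-! ### Duality by complex characters -/

theorem AddChar.natCard_complex (G : Type*) [AddCommGroup G] [Finite G] :
    Nat.card (AddChar G ℂ) = Nat.card G := by
  have := Fintype.ofFinite G
  rw [Nat.card_eq_fintype_card, Nat.card_eq_fintype_card, AddChar.card_eq]

/-- The character `ψ` of `Q` is trivial on no nonzero `R`-submodule. -/
def IsSeparating (R : Type*) {Q : Type*} [CommRing R] [AddCommGroup Q] [Module R Q]
    (ψ : AddChar Q ℂ) : Prop :=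
  ∀ q : Q, (∀ r : R, ψ (r • q) = 1) → q = 0

theorem IsCocyclic.socle_le {R Q : Type*} [CommRing R] [AddCommGroup Q] [Module R Q]
    (h : IsCocyclic R Q) {L : Submodule R Q} (hL : L ≠ ⊥) : socle R Q ≤ L := by
  have hat : IsAtom (socle R Q) := isSimpleModule_iff_isAtom.1 h.simple_socle
  rcases hat.le_iff.1 (inf_le_left : socle R Q ⊓ L ≤ socle R Q) with h0 | h0
  · exact absurd h0 (h.essential_socle L hL)
  · exact inf_eq_left.1 h0

theorem IsCocyclic.exists_isSeparating {R Q : Type*} [CommRing R] [AddCommGroup Q] [Module R Q]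
    [Finite Q] (h : IsCocyclic R Q) : ∃ ψ : AddChar Q ℂ, IsSeparating R ψ := by
  have hat : IsAtom (socle R Q) := isSimpleModule_iff_isAtom.1 h.simple_socle
  -- Every nonzero submodule contains the socle, so a character nontrivial at one `z` in the socle
  -- is nontrivial on all of them.
  obtain ⟨z, hz, hz0⟩ := Submodule.exists_mem_ne_zero_of_ne_bot hat.1
  obtain ⟨ψ, hψ⟩ := AddChar.exists_apply_ne_zero.2 hz0
  refine ⟨ψ, fun q hq => ?_⟩
  by_contra hq0
  have hL : Submodule.span R {q} ≠ ⊥ := by simpa using hq0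
  obtain ⟨r, hr⟩ := Submodule.mem_span_singleton.1 (h.socle_le hL hz)
  exact hψ (hr ▸ hq r)

section Duality

variable {A Q : Type*} [CommRing A] [AddCommGroup Q] [Module A Q] {ψ : AddChar Q ℂ}

/-- The pairing of a module with the ring of scalars defined by a character, as a function of
the scalar. -/
def pairingLeft (ψ : AddChar Q ℂ) (a : A) : AddChar Q ℂ :=
  ψ.compAddMonoidHom (DistribSMul.toAddMonoidHom Q a)

/-- The pairing of a module with the ring of scalars defined by a character, as a function of
the vector. -/
def pairingRight (A : Type*) [CommRing A] [Module A Q] (ψ : AddChar Q ℂ) (q : Q) : AddChar A ℂ :=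
  ψ.compAddMonoidHom (LinearMap.toSpanSingleton A Q q).toAddMonoidHom

@[simp]
theorem pairingLeft_apply (a : A) (q : Q) : pairingLeft ψ a q = ψ (a • q) := rfl

@[simp]
theorem pairingRight_apply (a : A) (q : Q) : pairingRight A ψ q a = ψ (a • q) := rfl

theorem AddChar.eq_iff_sub {G : Type*} [AddCommGroup G] (χ : AddChar G ℂ) {x y : G} :
    χ x = χ y ↔ χ (x - y) = 1 := by
  have hy : χ y ≠ 0 := by
    intro h0
    have := χ.map_add_eq_mul y (-y)
    simp [h0] at this
  have : χ x = χ (x - y) * χ y := by rw [← χ.map_add_eq_mul, sub_add_cancel]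
  rw [this]
  exact mul_eq_right₀ hy

theorem pairingLeft_injective [FaithfulSMul A Q] (hψ : IsSeparating A ψ) :
    Function.Injective (pairingLeft (A := A) ψ) := by
  intro a b hab
  refine FaithfulSMul.eq_of_smul_eq_smul (α := Q) fun q => sub_eq_zero.1 (hψ _ fun r => ?_)
  have := DFunLike.congr_fun hab (r • q)
  rw [pairingLeft_apply, pairingLeft_apply, AddChar.eq_iff_sub] at this
  rwa [smul_sub, smul_comm r a, smul_comm r b]

theorem pairingRight_injective (hψ : IsSeparating A ψ) :
    Function.Injective (pairingRight A ψ) := by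
  intro q q' h
  refine sub_eq_zero.1 (hψ _ fun r => ?_)
  have := DFunLike.congr_fun h r
  rwa [pairingRight_apply, pairingRight_apply, AddChar.eq_iff_sub, ← smul_sub] at this

variable [Finite Q]

theorem IsSeparating.finite [FaithfulSMul A Q] (hψ : IsSeparating A ψ) : Finite A := by
  have : Finite (AddChar Q ℂ) := Nat.finite_of_card_ne_zero (by
    rw [AddChar.natCard_complex]; exact Nat.card_pos.ne')
  exact Finite.of_injective _ (pairingLeft_injective hψ)

/-- The pairing embeds each of `A` and `Q` into the dual of the other, and a finite group has as
many characters as elements. -/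
theorem IsSeparating.natCard_eq [FaithfulSMul A Q] (hψ : IsSeparating A ψ) :
    Nat.card A = Nat.card Q := by
  have := hψ.finite
  have : Finite (AddChar Q ℂ) := Nat.finite_of_card_ne_zero (by
    rw [AddChar.natCard_complex]; exact Nat.card_pos.ne')
  have : Finite (AddChar A ℂ) := Nat.finite_of_card_ne_zero (by
    rw [AddChar.natCard_complex]; exact Nat.card_pos.ne')
  apply le_antisymm
  · rw [← AddChar.natCard_complex Q]
    exact Nat.card_le_card_of_injective _ (pairingLeft_injective hψ)
  · rw [← AddChar.natCard_complex A]
    exact Nat.card_le_card_of_injective _ (pairingRight_injective hψ)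

theorem bijective_of_natCard_eq {α β : Type*} [Finite α] [Nonempty α] {f : α → β}
    (hf : Function.Injective f) (h : Nat.card β = Nat.card α) : Function.Bijective f := by
  have : Finite β := Nat.finite_of_card_ne_zero (h ▸ Nat.card_pos.ne')
  exact (Nat.bijective_iff_injective_and_card f).2 ⟨hf, h.symm⟩

/-- A character of `Q / mQ`, pulled back to `Q`, is pairing with some scalar `a`. Triviality on `mQ`
makes `ψ` trivial on the submodules generated by the vectors `(a * r) • q` with `r ∈ m`, so `a`
kills `m`. -/
theorem IsSeparating.natCard_quotient_le [FaithfulSMul A Q] (hψ : IsSeparating A ψ)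
    (m : Ideal A) :
    Nat.card (Q ⧸ (m • ⊤ : Submodule A Q)) ≤ Nat.card m.annihilator := by
  have := hψ.finite
  have : Finite (Q ⧸ (m • ⊤ : Submodule A Q)) :=
    Finite.of_surjective _ (Submodule.mkQ_surjective _)
  have hb : Function.Bijective (pairingLeft (A := A) ψ) := 
    bijective_of_natCard_eq (pairingLeft_injective hψ)
      ((AddChar.natCard_complex Q).trans hψ.natCard_eq.symm)
  rw [← AddChar.natCard_complex]
  have key : ∀ χ : AddChar (Q ⧸ (m • ⊤ : Submodule A Q)) ℂ, ∃ a : m.annihilator,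
      pairingLeft ψ (a : A) = χ.compAddMonoidHom (m • ⊤ : Submodule A Q).mkQ.toAddMonoidHom := by
    intro χ
    obtain ⟨a, ha⟩ := hb.2 (χ.compAddMonoidHom (m • ⊤ : Submodule A Q).mkQ.toAddMonoidHom)
    refine ⟨⟨a, Submodule.mem_annihilator.2 fun r hr => ?_⟩, ha⟩
    refine FaithfulSMul.eq_of_smul_eq_smul (α := Q) fun q => ?_
    rw [zero_smul]
    refine hψ _ fun b => ?_
    have h1 := DFunLike.congr_fun ha (r • b • q)
    have h2 : (m • ⊤ : Submodule A Q).mkQ (r • b • q) = 0 :=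
      (Submodule.Quotient.mk_eq_zero _).2 (Submodule.smul_mem_smul hr trivial)
    rw [pairingLeft_apply, AddChar.compAddMonoidHom_apply, LinearMap.toAddMonoidHom_coe, h2,
      AddChar.map_zero_eq_one] at h1
    rw [← h1]
    congr 1
    simp only [smul_eq_mul, smul_smul]
    congr 1
    ring
  choose f hf using key
  refine Nat.card_le_card_of_injective f fun χ χ' h => DFunLike.ext _ _ fun x => ?_
  obtain ⟨q, rfl⟩ := Submodule.mkQ_surjective _ x
  exact DFunLike.congr_fun ((hf χ).symm.trans ((congrArg _ (congrArg _ h)).trans (hf χ'))) q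

end Duality

/-- Both modules are identified with the dual of `A`. The composite is linear because the pairing
with `A` determines a vector. -/
theorem IsSeparating.nonempty_linearEquiv {A Q Q' : Type*} [CommRing A] [Finite A]
    [AddCommGroup Q] [Module A Q] [AddCommGroup Q'] [Module A Q'] [Finite Q] [Finite Q']
    {ψ : AddChar Q ℂ} {ψ' : AddChar Q' ℂ} (hψ : IsSeparating A ψ) (hψ' : IsSeparating A ψ')
    (hQ : Nat.card Q = Nat.card A) (hQ' : Nat.card Q' = Nat.card A) :
    Nonempty (Q ≃ₗ[A] Q') := by
  let e := Equiv.ofBijective _ (bijective_of_natCard_eq (pairingRight_injective hψ)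
    ((AddChar.natCard_complex A).trans hQ.symm))
  let e' := Equiv.ofBijective _ (bijective_of_natCard_eq (pairingRight_injective hψ')
    ((AddChar.natCard_complex A).trans hQ'.symm))
  have he : ∀ (q : Q) (a : A), ψ' (a • e'.symm (e q)) = ψ (a • q) := fun q a =>
    DFunLike.congr_fun (e'.apply_symm_apply (e q)) a
  refine ⟨LinearEquiv.ofBijective
    { toFun := fun q => e'.symm (e q)
      map_add' := fun x y => pairingRight_injective hψ' (DFunLike.ext _ _ fun a => ?_)
      map_smul' := fun b x => pairingRight_injective hψ' (DFunLike.ext _ _ fun a => ?_) }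
    (e.trans e'.symm).bijective⟩
  · rw [pairingRight_apply, pairingRight_apply, he, smul_add, smul_add, AddChar.map_add_eq_mul,
      AddChar.map_add_eq_mul, he, he]
  · rw [pairingRight_apply, pairingRight_apply, he, RingHom.id_apply, smul_smul, smul_smul, he]

/-- Faithfulness over `R / J` is not needed: `Q` embeds into the dual of `R / J`, and the bound on
`|R / J|` makes this embedding bijective. -/
theorem IsCocyclic.nonempty_linearEquiv {R Q Q' : Type*} [CommRing R]
    [AddCommGroup Q] [Module R Q] [AddCommGroup Q'] [Module R Q'] [Finite Q] [Finite Q']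
    (h : IsCocyclic R Q) (h' : IsCocyclic R Q') (hQ : Nat.card Q = Nat.card Q') (J : Ideal R)
    [Finite (R ⧸ J)] (hJ : J ≤ Module.annihilator R Q) (hJ' : J ≤ Module.annihilator R Q')
    (hcard : Nat.card (R ⧸ J) ≤ Nat.card Q) : Nonempty (Q ≃ₗ[R] Q') := by
  have ht : Module.IsTorsionBySet R Q J := (Module.isTorsionBySet_iff_subset_annihilator _ _).2 hJ
  have ht' : Module.IsTorsionBySet R Q' J := (Module.isTorsionBySet_iff_subset_annihilator _ _).2 hJ'
  let _ := ht.module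
  let _ := ht'.module
  have : IsScalarTower R (R ⧸ J) Q := ht.isScalarTower
  have : IsScalarTower R (R ⧸ J) Q' := ht'.isScalarTower
  obtain ⟨ψ, hψ⟩ := h.exists_isSeparating
  obtain ⟨ψ', hψ'⟩ := h'.exists_isSeparating
  have hs : IsSeparating (R ⧸ J) ψ := fun q hq => hψ q fun r => by
    have := hq (Ideal.Quotient.mk J r)
    rwa [Module.IsTorsionBySet.mk_smul] at this
  have hs' : IsSeparating (R ⧸ J) ψ' := fun q hq => hψ' q fun r => by
    have := hq (Ideal.Quotient.mk J r)
    rwa [Module.IsTorsionBySet.mk_smul] at this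
  have hge : Nat.card Q ≤ Nat.card (R ⧸ J) := by
    have : Finite (AddChar (R ⧸ J) ℂ) := Nat.finite_of_card_ne_zero (by
      rw [AddChar.natCard_complex]; exact Nat.card_pos.ne')
    rw [← AddChar.natCard_complex (R ⧸ J)]
    exact Nat.card_le_card_of_injective _ (pairingRight_injective hs)
  have heq := le_antisymm hge hcard
  obtain ⟨e⟩ := hs.nonempty_linearEquiv hs' heq (hQ ▸ heq)
  exact ⟨e.restrictScalars R⟩

/-! ### Nilpotence, Nakayama and the number of generators -/

/-- Fitting's lemma splits `Q` into the kernel and the image of a power of `r ∈ m`. If both were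
nonzero, both would contain the socle; the kernel is nonzero, so the image vanishes. -/
theorem IsCocyclic.exists_pow_le_annihilator {R Q : Type*} [CommRing R] [AddCommGroup Q]
    [Module R Q] [Finite Q] (h : IsCocyclic R Q) {m : Ideal R} (hfg : m.FG)
    (hm : ∀ r ∈ m, ∀ q ∈ socle R Q, r • q = 0) : ∃ k, m ^ k ≤ Module.annihilator R Q := by
  refine Ideal.exists_pow_le_of_le_radical_of_fg (fun r hr => ?_) hfg
  have hat : IsAtom (socle R Q) := isSimpleModule_iff_isAtom.1 h.simple_socle
  obtain ⟨z, hz, hz0⟩ := Submodule.exists_mem_ne_zero_of_ne_bot hat.1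
  let f : Module.End R Q := LinearMap.lsmul R Q r
  have hfit := LinearMap.eventually_isCompl_ker_pow_range_pow f
  obtain ⟨n, hn⟩ := Filter.eventually_atTop.1 hfit
  have hf : ∀ (k : ℕ) (q : Q), (f ^ k) q = r ^ k • q := by
    intro k
    induction k with
    | zero => simp
    | succ k ih => intro q; rw [pow_succ', Module.End.mul_apply, ih, pow_succ', mul_smul]; rfl
  -- The exponent must be positive for the power of `r` to kill `z`.
  have hn := hn (n + 1) (Nat.le_succ n)
  have hker : LinearMap.ker (f ^ (n + 1)) ≠ ⊥ := by
    refine (Submodule.ne_bot_iff _).2 ⟨z, ?_, hz0⟩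
    rw [LinearMap.mem_ker, hf, pow_succ, mul_smul, hm r hr z hz, smul_zero]
  have hrange : LinearMap.range (f ^ (n + 1)) = ⊥ := by
    by_contra hne
    have : z ∈ LinearMap.ker (f ^ (n + 1)) ⊓ LinearMap.range (f ^ (n + 1)) :=
      ⟨h.socle_le hker hz, h.socle_le hne hz⟩
    rw [hn.inf_eq_bot] at this
    exact hz0 this
  refine ⟨n + 1, Module.mem_annihilator.2 fun q => ?_⟩
  rw [← hf]
  exact (Submodule.mem_bot R).1 (hrange ▸ LinearMap.mem_range_self _ q)

theorem Submodule.eq_top_of_sup_smul_top {R Q : Type*} [CommRing R] [AddCommGroup Q]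
    [Module R Q] {m : Ideal R} (hm : ∃ k, m ^ k ≤ Module.annihilator R Q) {N : Submodule R Q}
    (hN : N ⊔ m • ⊤ = ⊤) : N = ⊤ := by
  have hstep : ∀ k, N ⊔ m ^ k • ⊤ = ⊤ := by
    intro k
    induction k with
    | zero => simp
    | succ k ih =>
      have h1 : m • (⊤ : Submodule R Q) ≤ N ⊔ m ^ (k + 1) • ⊤ := by
        conv_lhs => rw [← ih]
        rw [Submodule.smul_sup, ← Submodule.mul_smul, ← pow_succ']
        exact sup_le_sup_right Submodule.smul_le_right _
      rw [eq_top_iff]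
      calc ⊤ = N ⊔ m • ⊤ := hN.symm
        _ ≤ _ := sup_le le_sup_left h1
  obtain ⟨k, hk⟩ := hm
  have h0 : m ^ k • (⊤ : Submodule R Q) = ⊥ := by
    refine le_bot_iff.1 (Submodule.smul_le.2 fun r hr q _ => ?_)
    exact Module.mem_annihilator.1 (hk hr) q
  simpa [h0] using hstep k

theorem HasPrimeResidue.exists_finset_span_eq_top {R Q : Type*} [CommRing R] [AddCommGroup Q]
    [Module R Q] [Finite Q] {p t : ℕ} {m : Ideal R} (h : HasPrimeResidue p m)
    (hm : ∃ k, m ^ k ≤ Module.annihilator R Q)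
    (ht : Nat.card (Q ⧸ (m • ⊤ : Submodule R Q)) ≤ p ^ t) :
    ∃ s : Finset Q, s.card ≤ t ∧ Submodule.span R (s : Set Q) = ⊤ := by
  classical
  have := h.isMaximal
  let _ := Ideal.Quotient.field m
  have : Finite (Q ⧸ (m • ⊤ : Submodule R Q)) :=
    Finite.of_surjective _ (Submodule.mkQ_surjective _)
  have hcard := Module.natCard_eq_pow_finrank (K := R ⧸ m)
    (V := Q ⧸ (m • ⊤ : Submodule R Q))
  rw [h.natCard_quotient] at hcard
  rw [hcard, Nat.pow_le_pow_iff_right h.prime.one_lt] at ht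
  let b := Module.finBasis (R ⧸ m) (Q ⧸ (m • ⊤ : Submodule R Q))
  choose c hc using fun i => Submodule.mkQ_surjective (m • ⊤ : Submodule R Q) (b i)
  refine ⟨Finset.univ.image c, Finset.card_image_le.trans (by simpa using ht),
    Submodule.eq_top_of_sup_smul_top hm ?_⟩
  have h1 := Submodule.restrictScalars_span R (R ⧸ m) Ideal.Quotient.mk_surjective (Set.range b)
  rw [b.span_eq, Submodule.restrictScalars_top] at h1
  have h2 : (Submodule.span R (Set.range c)).map (m • ⊤ : Submodule R Q).mkQ = ⊤ := by
    rw [Submodule.map_span, ← Set.range_comp, h1]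
    congr 2
    exact funext hc
  have h3 := congrArg (Submodule.comap (m • ⊤ : Submodule R Q).mkQ) h2
  rw [Submodule.comap_map_eq, Submodule.ker_mkQ, Submodule.comap_top] at h3
  simpa using h3

theorem HasPrimeResidue.map_mk {R : Type*} [CommRing R] {p : ℕ} {m J : Ideal R}
    (h : HasPrimeResidue p m) (hJ : J ≤ m) :
    HasPrimeResidue p (m.map (Ideal.Quotient.mk J)) where
  prime := h.prime
  natCast_mem := by simpa using Ideal.mem_map_of_mem (Ideal.Quotient.mk J) h.natCast_mem
  exists_sub_mem a := by
    obtain ⟨a, rfl⟩ := Ideal.Quotient.mk_surjective a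
    obtain ⟨c, hc, hac⟩ := h.exists_sub_mem a
    exact ⟨c, hc, by simpa using Ideal.mem_map_of_mem (Ideal.Quotient.mk J) hac⟩
  ne_top hm := by
    have h1 := congrArg (Ideal.comap (Ideal.Quotient.mk J)) hm
    rw [Ideal.comap_map_of_surjective _ Ideal.Quotient.mk_surjective, ← RingHom.ker_eq_comap_bot,
      Ideal.mk_ker, Ideal.comap_top, sup_eq_left.2 hJ] at h1
    exact h.ne_top h1

/-- A cocyclic module of order `p ^ 6` over a ring with a maximal ideal generated by two elements
is generated by three elements, and by two unless the cube of the maximal ideal kills it. -/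
theorem IsCocyclic.generators {R Q : Type*} [CommRing R] [AddCommGroup Q] [Module R Q]
    {p : ℕ} {m : Ideal R} {u v : R} (h : IsCocyclic R Q) (hp : HasPrimeResidue p m)
    (huv : m = Ideal.span {u, v}) (hm : ∀ r ∈ m, ∀ q ∈ socle R Q, r • q = 0)
    (hQ : Nat.card Q = p ^ 6) :
    (∃ s : Finset Q, s.card ≤ 3 ∧ Submodule.span R (s : Set Q) = ⊤) ∧
      ((⊤ : Submodule R Q).spanFinrank = 3 → m ^ 3 ≤ Module.annihilator R Q) := by
  have : Finite Q := Nat.finite_of_card_ne_zero (hQ ▸ (pow_pos hp.prime.pos 6).ne')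
  obtain ⟨k, hk⟩ := h.exists_pow_le_annihilator
    (huv ▸ Submodule.fg_span (Set.toFinite _)) hm
  obtain ⟨ψ, hψ⟩ := h.exists_isSeparating
  let J := Module.annihilator R Q
  have ht : Module.IsTorsionBySet R Q J := Module.isTorsionBySet_annihilator R Q
  let _ : Module (R ⧸ J) Q := ht.module
  have : IsScalarTower R (R ⧸ J) Q := ht.isScalarTower
  have hJm : J ≤ m := by
    have hJtop : J ≠ ⊤ := by
      intro htop
      have := (Ideal.eq_top_iff_one J).1 htop
      have hQ1 : Subsingleton Q := subsingleton_of_forall_eq 0 fun q => by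
        simpa using Module.mem_annihilator.1 this q
      have := Nat.card_of_subsingleton (0 : Q)
      rw [hQ] at this
      have := Nat.one_lt_pow (n := 6) (by norm_num) hp.prime.one_lt
      omega
    obtain ⟨M, hM, hJM⟩ := Ideal.exists_le_maximal J hJtop
    -- A power of `m` lies in `J`, so `m` is the only maximal ideal above `J`.
    have hmM : m ≤ M := hM.isPrime.le_of_pow_le (hk.trans hJM)
    rwa [hp.isMaximal.eq_of_le hM.ne_top hmM]
  have hψA : IsSeparating (R ⧸ J) ψ := fun q hq => hψ q fun r => hq (Ideal.Quotient.mk J r)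
  have : FaithfulSMul (R ⧸ J) Q := ⟨fun {a b} hab => by
    obtain ⟨a, rfl⟩ := Ideal.Quotient.mk_surjective a
    obtain ⟨b, rfl⟩ := Ideal.Quotient.mk_surjective b
    refine Ideal.Quotient.eq.2 (Module.mem_annihilator.2 fun q => ?_)
    rw [sub_smul, sub_eq_zero]
    exact hab q⟩
  have := hψA.finite
  have hpA := hp.map_mk hJm
  set mA := m.map (Ideal.Quotient.mk J) with hmA
  have hkA : mA ^ k = ⊥ := by
    rw [hmA, ← Ideal.map_pow, eq_bot_iff, Ideal.map_le_iff_le_comap, ← RingHom.ker_eq_comap_bot,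
      Ideal.mk_ker]
    exact hk
  have huvA : mA = Ideal.span {Ideal.Quotient.mk J u, Ideal.Quotient.mk J v} := by
    rw [hmA, huv, Ideal.map_span, Set.image_pair]
  have hb := hpA.annihilator_bound ⟨k, hkA⟩ huvA (hψA.natCard_eq.trans hQ)
  have hgen : ∀ t, Nat.card mA.annihilator ≤ p ^ t →
      ∃ s : Finset Q, s.card ≤ t ∧ Submodule.span R (s : Set Q) = ⊤ := by
    intro t ht
    obtain ⟨s, hs, hs'⟩ := hpA.exists_finset_span_eq_top (Q := Q) ⟨k, by rw [hkA]; exact bot_le⟩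
      ((hψA.natCard_quotient_le mA).trans ht)
    refine ⟨s, hs, ?_⟩
    rw [← Submodule.restrictScalars_span R (R ⧸ J) Ideal.Quotient.mk_surjective, hs',
      Submodule.restrictScalars_top]
  refine ⟨hgen 3 hb.1, fun h3 => ?_⟩
  -- Otherwise two generators would suffice.
  have hlt : p ^ 2 < Nat.card mA.annihilator := by
    by_contra hle
    obtain ⟨s, hs, hs'⟩ := hgen 2 (not_lt.1 hle)
    have := Submodule.spanFinrank_span_le_ncard_of_finite (R := R) s.finite_toSet
    rw [hs', h3, Set.ncard_coe_finset] at this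
    omega
  have h0 := hb.2 hlt
  rw [hmA, ← Ideal.map_pow, eq_bot_iff, Ideal.map_le_iff_le_comap, ← RingHom.ker_eq_comap_bot,
    Ideal.mk_ker] at h0
  exact h0

theorem IsCocyclic.generators_and_linearEquiv {R Q P : Type*} [CommRing R] [AddCommGroup Q]
    [Module R Q] [AddCommGroup P] [Module R P]
    {p : ℕ} {m : Ideal R} {u v : R} (h : IsCocyclic R Q) (hp : HasPrimeResidue p m)
    (huv : m = Ideal.span {u, v}) (hm : ∀ r ∈ m, ∀ q ∈ socle R Q, r • q = 0)
    (hQ : Nat.card Q = p ^ 6) (hP : IsCocyclic R P) (hPcard : Nat.card P = p ^ 6)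
    (hPm : m ^ 3 ≤ Module.annihilator R P) :
    (∃ s : Finset Q, s.card ≤ 3 ∧ Submodule.span R (s : Set Q) = ⊤) ∧
      ((⊤ : Submodule R Q).spanFinrank = 3 → Nonempty (Q ≃ₗ[R] P)) := by
  have : Finite Q := Nat.finite_of_card_ne_zero (hQ ▸ (pow_pos hp.prime.pos 6).ne')
  have : Finite P := Nat.finite_of_card_ne_zero (hPcard ▸ (pow_pos hp.prime.pos 6).ne')
  obtain ⟨h1, h2⟩ := h.generators hp huv hm hQ
  obtain ⟨hfin, hle⟩ := hp.natCard_quotient_cube_le huv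
  exact ⟨h1, fun h3 => h.nonempty_linearEquiv hP (hQ.trans hPcard.symm) (m ^ 3) (h2 h3) hPm
    (hQ ▸ hle)⟩

/-! ### The modules `P_m` in integral coordinates -/

/-- By Bézout, a nonzero class modulo `p ^ (k + 1)` generates a subgroup containing the class of `p
^ k`. -/
theorem exists_dvd_mul_sub_pow {p : ℕ} (hp : p.Prime) {k : ℕ} {z : ℤ}
    (hz : ¬ (p : ℤ) ^ (k + 1) ∣ z) : ∃ c : ℤ, (p : ℤ) ^ (k + 1) ∣ c * z - (p : ℤ) ^ k := by
  have hg : Int.gcd z ((p : ℤ) ^ (k + 1)) ∣ p ^ (k + 1) := by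
    have := Int.gcd_dvd_right z ((p : ℤ) ^ (k + 1))
    exact_mod_cast this
  obtain ⟨j, hj, hgj⟩ := (Nat.dvd_prime_pow hp).1 hg
  have hjk : j ≤ k := by
    by_contra hlt
    obtain rfl : j = k + 1 := by omega
    refine hz ?_
    have := Int.gcd_dvd_left z ((p : ℤ) ^ (k + 1))
    rw [hgj] at this
    exact_mod_cast this
  obtain ⟨i, rfl⟩ := Nat.exists_eq_add_of_le hjk
  have hb := Int.gcd_eq_gcd_ab z ((p : ℤ) ^ (j + i + 1))
  rw [hgj] at hb
  push_cast at hb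
  refine ⟨(p : ℤ) ^ i * Int.gcdA z ((p : ℤ) ^ (j + i + 1)),
    -((p : ℤ) ^ i * Int.gcdB z ((p : ℤ) ^ (j + i + 1))), ?_⟩
  rw [pow_add (p : ℤ) j i, hb]
  ring

/-- The element of `P_m` with given integral coordinates. -/
def intVec (p m : ℕ) (z : Fin m → ℤ) : PGroup p m := fun n => (z n : ZMod (p ^ (m - (n : ℕ))))

theorem intVec_surjective (p m : ℕ) : Function.Surjective (intVec p m) := fun a => by
  choose z hz using fun n => ZMod.intCast_surjective (a n)
  exact ⟨z, funext hz⟩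

theorem intVec_eq_iff {p m : ℕ} {z w : Fin m → ℤ} :
    intVec p m z = intVec p m w ↔ ∀ n : Fin m, (p : ℤ) ^ (m - (n : ℕ)) ∣ w n - z n := by
  rw [funext_iff]
  refine forall_congr' fun n => ?_
  simp only [intVec]
  rw [ZMod.intCast_eq_intCast_iff_dvd_sub]
  push_cast
  rfl

theorem intVec_zero (p m : ℕ) : intVec p m 0 = 0 := by
  funext n
  simp [intVec]

theorem zsmul_intVec (p m : ℕ) (c : ℤ) (z : Fin m → ℤ) :
    c • intVec p m z = intVec p m (c • z) := by
  funext n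
  simp [intVec]

/-- The shift of integral vectors. -/
def shiftInt (m : ℕ) (z : Fin m → ℤ) (n : Fin m) : ℤ :=
  if h : (n : ℕ) + 1 < m then z ⟨n + 1, h⟩ else 0

theorem shiftP_intVec (p m : ℕ) (z : Fin m → ℤ) :
    shiftP p m (intVec p m z) = (p : ℤ) • intVec p m (shiftInt m z) := by
  funext n
  by_cases h : (n : ℕ) + 1 < m
  · simp only [shiftP, shiftInt, intVec, h, AddMonoidHom.coe_toIntLinearMap, AddMonoidHom.coe_mk,
      ZeroHom.coe_mk, dite_true, Pi.smul_apply]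
    rw [mulP_intCast]
    simp
  · simp [shiftP, shiftInt, intVec, h]

/-- The vector `(p ^ 2, 0, 0)` generates the socle. If `i` is the last index with a nonzero
coordinate, `i` shifts bring that coordinate to position `0` with a factor `p ^ i`, and an integer
multiple turns it into `p ^ 2` while killing the rest. -/
theorem exists_zsmul_shiftP_pow_eq {p : ℕ} (hp : p.Prime) {a : PGroup p 3} (ha : a ≠ 0) :
    ∃ (c : ℤ) (i : ℕ), c • ((shiftP p 3) ^ i) a = intVec p 3 ![(p : ℤ) ^ 2, 0, 0] := by
  obtain ⟨z, rfl⟩ := intVec_surjective p 3 a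
  have hne : ¬ ((p : ℤ) ^ 3 ∣ z 0 ∧ (p : ℤ) ^ 2 ∣ z 1 ∧ (p : ℤ) ^ 1 ∣ z 2) := by
    rintro ⟨h0, h1, h2⟩
    refine ha ?_
    rw [← intVec_zero, eq_comm, intVec_eq_iff]
    intro n
    fin_cases n
    · simpa using h0
    · simpa using h1
    · simpa using h2
  by_cases h2 : (p : ℤ) ^ 1 ∣ z 2
  · by_cases h1 : (p : ℤ) ^ 2 ∣ z 1
    · have h0 : ¬ (p : ℤ) ^ 3 ∣ z 0 := fun h0 => hne ⟨h0, h1, h2⟩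
      obtain ⟨c, hc⟩ := exists_dvd_mul_sub_pow hp (k := 2) h0
      refine ⟨c, 0, ?_⟩
      rw [pow_zero, Module.End.one_apply, zsmul_intVec, eq_comm, intVec_eq_iff]
      intro n
      fin_cases n
      · simpa using hc
      · simpa using h1.mul_left c
      · simpa using h2.mul_left c
    · obtain ⟨c, hc⟩ := exists_dvd_mul_sub_pow hp (k := 1) h1
      refine ⟨c, 1, ?_⟩
      rw [pow_one, shiftP_intVec, smul_smul, zsmul_intVec, eq_comm, intVec_eq_iff]
      obtain ⟨d, hd⟩ := hc
      obtain ⟨e, he⟩ := h2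
      intro n
      fin_cases n
      · refine ⟨d, ?_⟩
        simp [shiftInt]
        linear_combination (p : ℤ) * hd
      · refine ⟨c * e, ?_⟩
        simp [shiftInt]
        rw [he]
        ring
      · simp [shiftInt]
  · obtain ⟨c, hc⟩ := exists_dvd_mul_sub_pow hp (k := 0) (by simpa using h2)
    refine ⟨c, 2, ?_⟩
    rw [pow_two, Module.End.mul_apply, shiftP_intVec, map_zsmul, shiftP_intVec, smul_smul, smul_smul,
      zsmul_intVec, eq_comm, intVec_eq_iff]
    obtain ⟨d, hd⟩ := hc
    intro n
    fin_cases n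
    · refine ⟨d, ?_⟩
      simp [shiftInt]
      linear_combination (p : ℤ) ^ 2 * hd
    · simp [shiftInt]
    · simp [shiftInt]

theorem natCard_pGroup_three (p : ℕ) [hp : Fact p.Prime] : Nat.card (PGroup p 3) = p ^ 6 := by
  rw [Nat.card_pi]
  simp [Fin.prod_univ_three]
  ring

theorem IsCocyclic.of_forall_mem {R M : Type*} [CommRing R] [AddCommGroup M] [Module R M] {e : M}
    (he : e ≠ 0) (h : ∀ q : M, q ≠ 0 → ∃ r : R, r • q = e) : IsCocyclic R M := by
  have hmem : ∀ N : Submodule R M, N ≠ ⊥ → Submodule.span R {e} ≤ N := by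
    intro N hN
    obtain ⟨q, hq, hq0⟩ := Submodule.exists_mem_ne_zero_of_ne_bot hN
    obtain ⟨r, rfl⟩ := h q hq0
    exact (Submodule.span_singleton_le_iff_mem _ _).2 (N.smul_mem r hq)
  have hat : IsAtom (Submodule.span R {e}) :=
    ⟨by simpa using he, fun N hN => by
      by_contra h0
      exact absurd (hmem N h0) (not_le_of_gt hN)⟩
  have hs : socle R M = Submodule.span R {e} := by
    apply le_antisymm
    · refine sSup_le fun N hN => ?_
      have hN' : IsAtom N := isSimpleModule_iff_isAtom.1 hN
      exact (hN'.le_iff.1 (hmem N hN'.1)).resolve_left hat.1 |>.ge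
    · exact le_sSup (isSimpleModule_iff_isAtom.2 hat)
  refine ⟨by rw [hs]; exact isSimpleModule_iff_isAtom.2 hat, fun N hN => ?_⟩
  rw [hs, inf_eq_left.2 (hmem N hN)]
  exact hat.1

section Action

variable {R M : Type*} [CommRing R] [AddCommGroup M] [Module R M] {p : ℕ}

/-- Only the scalar `y` acting as the shift matters, so one argument covers all three model modules.
-/
theorem IsCocyclic.of_shiftP [hp : Fact p.Prime] (e : PGroup p 3 ≃+ M) {y : R}
    (hy : ∀ a, y • e a = e (shiftP p 3 a)) : IsCocyclic R M := by
  have hpow : ∀ (i : ℕ) (a : PGroup p 3), y ^ i • e a = e (((shiftP p 3) ^ i) a) := by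
    intro i
    induction i with
    | zero => simp
    | succ i ih => intro a; rw [pow_succ', mul_smul, ih, hy, pow_succ', Module.End.mul_apply]
  refine IsCocyclic.of_forall_mem (e := e (intVec p 3 ![(p : ℤ) ^ 2, 0, 0])) ?_ fun q hq => ?_
  · rw [Ne, EmbeddingLike.map_eq_zero_iff, ← intVec_zero, eq_comm, intVec_eq_iff]
    intro h
    have h0 := h 0
    simp only [Fin.val_zero, Nat.sub_zero, Matrix.cons_val_zero, Pi.zero_apply, sub_zero] at h0
    have h1 : p ^ 3 ∣ p ^ 2 := by exact_mod_cast h0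
    have := (Nat.pow_dvd_pow_iff_le_right hp.out.one_lt).1 h1
    omega
  · obtain ⟨a, rfl⟩ := e.surjective q
    obtain ⟨c, i, hc⟩ := exists_zsmul_shiftP_pow_eq hp.out (a := a) (by simpa using hq)
    refine ⟨(c : R) * y ^ i, ?_⟩
    rw [mul_smul, hpow, Int.cast_smul_eq_zsmul, ← map_zsmul, hc]

/-- The shift takes values in `p M`, so every element of `(p, y)` maps `M` into `p M`. Hence the
`m`-th power of this ideal maps `M` into `p ^ m M = 0`. -/
theorem pow_le_annihilator_of_shiftP {m : ℕ} (e : PGroup p m ≃+ M) {y : R}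
    (hy : ∀ a, y • e a = e (shiftP p m a)) :
    Ideal.span {(p : R), y} ^ m ≤ Module.annihilator R M := by
  have hy' : ∀ q : M, ∃ q', y • q = (p : R) • q' := by
    intro q
    obtain ⟨a, rfl⟩ := e.surjective q
    obtain ⟨z, rfl⟩ := intVec_surjective p m a
    refine ⟨e (intVec p m (shiftInt m z)), ?_⟩
    rw [hy, shiftP_intVec, map_zsmul, Nat.cast_smul_eq_nsmul ℤ, Nat.cast_smul_eq_nsmul R]
  have hm : ∀ r ∈ Ideal.span {(p : R), y}, ∀ q : M, ∃ q', r • q = (p : R) • q' := by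
    intro r hr q
    obtain ⟨a, b, rfl⟩ := Ideal.mem_span_pair.1 hr
    obtain ⟨q', hq'⟩ := hy' q
    refine ⟨a • q + b • q', ?_⟩
    rw [add_smul, mul_smul b, hq', smul_add, smul_smul, smul_smul, smul_smul, mul_comm a,
      mul_comm b]
  have hstep : ∀ j, Ideal.span {(p : R), y} ^ j • (⊤ : Submodule R M) ≤
      LinearMap.range (LinearMap.lsmul R M ((p : R) ^ j)) := by
    intro j
    induction j with
    | zero => intro q _; exact ⟨q, by simp⟩
    | succ j ih =>
      rw [pow_succ', Submodule.mul_smul, Submodule.smul_le]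
      intro r hr x hx
      obtain ⟨q, rfl⟩ := ih hx
      obtain ⟨q', hq'⟩ := hm r hr q
      refine ⟨q', ?_⟩
      rw [LinearMap.lsmul_apply, LinearMap.lsmul_apply, smul_comm, hq', smul_smul, pow_succ]
  intro r hr
  refine Module.mem_annihilator.2 fun q => ?_
  obtain ⟨q', hq'⟩ := hstep m (Submodule.smul_mem_smul hr (Submodule.mem_top (x := q)))
  rw [← hq', LinearMap.lsmul_apply]
  obtain ⟨a, rfl⟩ := e.surjective q'
  obtain ⟨z, rfl⟩ := intVec_surjective p m a
  rw [← Nat.cast_pow, Nat.cast_smul_eq_nsmul, ← map_nsmul, EmbeddingLike.map_eq_zero_iff,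
    ← natCast_zsmul, zsmul_intVec, ← intVec_zero, eq_comm, intVec_eq_iff]
  intro n
  push_cast
  simpa using (pow_dvd_pow (p : ℤ) (Nat.sub_le m n)).mul_right (z n)

theorem smul_socle_eq_zero {Q : Type*} [AddCommGroup Q] [Module R Q] {y : R}
    (e : PGroup p 1 ≃+ M) (hy : ∀ a, y • e a = e (shiftP p 1 a))
    (f : socle R Q ≃ₗ[R] M) : ∀ r ∈ Ideal.span {(p : R), y}, ∀ q ∈ socle R Q, r • q = 0 := by
  intro r hr q hq
  have h := pow_le_annihilator_of_shiftP e hy (by simpa using hr)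
  have h1 := Module.mem_annihilator.1 h (f ⟨q, hq⟩)
  rw [← map_smul, EmbeddingLike.map_eq_zero_iff] at h1
  exact congrArg Subtype.val h1

/-- The ideal kills the nonzero module `P_1`. -/
theorem span_ne_top_of_shiftP [hp : Fact p.Prime] {y : R}
    (e : PGroup p 1 ≃+ M) (hy : ∀ a, y • e a = e (shiftP p 1 a)) :
    Ideal.span {(p : R), y} ≠ ⊤ := by
  intro htop
  have h := pow_le_annihilator_of_shiftP e hy
  rw [htop, pow_one] at h
  have h1 := Module.mem_annihilator.1 (h (Submodule.mem_top (x := 1))) (e (intVec p 1 1))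
  rw [one_smul, EmbeddingLike.map_eq_zero_iff, ← intVec_zero, eq_comm, intVec_eq_iff] at h1
  have h2 := h1 0
  simp only [Fin.val_zero, Nat.sub_zero, pow_one, Pi.one_apply, Pi.zero_apply, sub_zero] at h2
  exact hp.out.one_lt.ne' (by exact_mod_cast Int.eq_one_of_dvd_one (by positivity) h2)

end Action

/-! ### Residue fields of `ℤ[x]` and `ℤ[x, x⁻¹, (1 - x)⁻¹]` -/

theorem exists_lt_intCast_sub_mem {R : Type*} [CommRing R] {p : ℕ} (hp : p.Prime) {m : Ideal R}
    (hpm : (p : R) ∈ m) (z : ℤ) : ∃ c : ℕ, c < p ∧ (z : R) - c ∈ m := by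
  have hp0 : (p : ℤ) ≠ 0 := by exact_mod_cast hp.ne_zero
  have h0 := Int.emod_nonneg z hp0
  have h1 := Int.emod_lt_of_pos z (show (0 : ℤ) < p by exact_mod_cast hp.pos)
  refine ⟨(z % p).toNat, by omega, ?_⟩
  have h2 : ((z % p).toNat : R) = ((z % p : ℤ) : R) := by
    rw [← Int.cast_natCast, Int.toNat_of_nonneg h0]
  have h3 : (z : R) - ((z % p : ℤ) : R) = ((z / p : ℤ) : R) * (p : R) := by
    have := congrArg (fun z : ℤ => (z : R)) (Int.emod_add_mul_ediv z p)
    push_cast at this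
    linear_combination -this
  rw [h2, h3]
  exact m.mul_mem_left _ hpm

theorem exists_intCast_sub_mem (p : ℕ) (a : ℤ) (f : ℤ[X]) :
    ∃ z : ℤ, f - z ∈ Ideal.span {(p : ℤ[X]), X - C a} := by
  refine ⟨f.eval a, Ideal.mem_span_pair.2 ?_⟩
  obtain ⟨g, hg⟩ := X_sub_C_dvd_sub_C_eval (a := a) (p := f)
  refine ⟨0, g, ?_⟩
  simp only [eq_intCast] at hg ⊢
  rw [hg]
  ring

theorem hasPrimeResidue_polynomial {p : ℕ} (hp : p.Prime) (a : ℤ)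
    (h : Ideal.span {(p : ℤ[X]), X - C a} ≠ ⊤) :
    HasPrimeResidue p (Ideal.span {(p : ℤ[X]), X - C a}) where
  prime := hp
  natCast_mem := Ideal.subset_span (by simp)
  exists_sub_mem f := by
    obtain ⟨z, hz⟩ := exists_intCast_sub_mem p a f
    obtain ⟨c, hc, hzc⟩ := exists_lt_intCast_sub_mem hp (m := Ideal.span {(p : ℤ[X]), X - C a})
      (Ideal.subset_span (by simp)) z
    exact ⟨c, hc, by simpa using add_mem hz hzc⟩
  ne_top := h

/-- Modulo the ideal `x` is `-1`, so the denominator `x (1 - x)` becomes `-2`, which is invertible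
modulo the odd prime `p`. Every fraction is therefore congruent to an integer. -/
theorem hasPrimeResidue_R₂ {p : ℕ} (hp : p.Prime) (h2 : p ≠ 2)
    (h : Ideal.span {(p : R₂), algebraMap ℤ[X] R₂ (X + 1)} ≠ ⊤) :
    HasPrimeResidue p (Ideal.span {(p : R₂), algebraMap ℤ[X] R₂ (X + 1)}) where
  prime := hp
  natCast_mem := Ideal.subset_span (by simp)
  exists_sub_mem r := by
    set m := Ideal.span {(p : R₂), algebraMap ℤ[X] R₂ (X + 1)} with hm
    have hpm : (p : R₂) ∈ m := Ideal.subset_span (by simp)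
    have hX : algebraMap ℤ[X] R₂ (X + 1) ∈ m := Ideal.subset_span (by simp)
    have hint : ∀ f : ℤ[X], ∃ z : ℤ, algebraMap ℤ[X] R₂ f - z ∈ m := by
      intro f
      obtain ⟨z, hz⟩ := exists_intCast_sub_mem p (-1) f
      refine ⟨z, ?_⟩
      obtain ⟨a, b, hab⟩ := Ideal.mem_span_pair.1 hz
      have := congrArg (algebraMap ℤ[X] R₂) hab
      simp only [map_sub, map_mul, map_add, map_intCast, map_natCast, map_neg, map_one,
        sub_neg_eq_add] at this
      rw [← this, ← map_one (algebraMap ℤ[X] R₂), ← map_add]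
      exact m.add_mem (m.mul_mem_left _ hpm) (m.mul_mem_left _ hX)
    obtain ⟨⟨f, s⟩, hfs⟩ := IsLocalization.surj (Submonoid.powers (X * (1 - X) : ℤ[X])) r
    obtain ⟨_, k, rfl⟩ := s
    obtain ⟨z, hz⟩ := hint f
    have hs : algebraMap ℤ[X] R₂ (X * (1 - X)) + 2 ∈ m := by
      have h3 : algebraMap ℤ[X] R₂ (X * (1 - X)) + 2 =
          algebraMap ℤ[X] R₂ (2 - X) * algebraMap ℤ[X] R₂ (X + 1) := by
        rw [← map_ofNat (algebraMap ℤ[X] R₂) 2, ← map_add, ← map_mul]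
        congr 1
        ring
      exact h3 ▸ m.mul_mem_left _ hX
    have hsk : algebraMap ℤ[X] R₂ (X * (1 - X)) ^ k - (-2) ^ k ∈ m := by
      obtain ⟨g, hg⟩ := sub_dvd_pow_sub_pow (algebraMap ℤ[X] R₂ (X * (1 - X))) (-2) k
      rw [hg, sub_neg_eq_add]
      exact m.mul_mem_right _ hs
    have hco : IsCoprime ((-2 : ℤ) ^ k) (p : ℤ) := by
      have h1 : Nat.Coprime 2 p := (Nat.coprime_primes Nat.prime_two hp).2 (Ne.symm h2)
      have h3 : IsCoprime (2 : ℤ) (p : ℤ) := by exact_mod_cast Nat.isCoprime_iff_coprime.2 h1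
      exact h3.neg_left.pow_left
    obtain ⟨u, v, huv⟩ := hco
    have huv' : (u : R₂) * (-2) ^ k + (v : R₂) * (p : R₂) = 1 := by
      have := congrArg (fun z : ℤ => (z : R₂)) huv
      push_cast at this
      exact this
    obtain ⟨c, hc, hzc⟩ := exists_lt_intCast_sub_mem hp hpm (u * z)
    refine ⟨c, hc, ?_⟩
    simp only [map_pow] at hfs
    generalize algebraMap ℤ[X] R₂ (X * (1 - X)) = S at hfs hsk
    -- With `r * S ^ k = f` and `u * (-2) ^ k + v * p = 1`, the fraction `r` is congruent to `u *
    -- f`, hence to `u * z`.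
    have : r - c = (((u * z : ℤ) : R₂) - c) + (u : R₂) * (algebraMap ℤ[X] R₂ f - z) -
        r * u * (S ^ k - (-2) ^ k) + r * v * (p : R₂) := by
      push_cast
      linear_combination (u : R₂) * hfs - r * huv'
    rw [this]
    exact m.add_mem (m.sub_mem (m.add_mem hzc (m.mul_mem_left _ hz)) (m.mul_mem_left _ hsk))
      (m.mul_mem_left _ hpm)
  ne_top := h

theorem X_sub_C_smul_pMod (p m : ℕ) (a : PGroup p m) :
    (X - C 0 : ℤ[X]) • (Module.AEval'.of (shiftP p m)).toAddEquiv a =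
      (Module.AEval'.of (shiftP p m)).toAddEquiv (shiftP p m a) := by
  rw [map_zero, sub_zero]
  exact Module.AEval'.X_smul_of (shiftP p m) a

theorem X_sub_C_smul_pShift (p m : ℕ) (a : PGroup p m) :
    (X - C (-1) : ℤ[X]) • (Module.AEval'.of (shiftP p m - 1)).toAddEquiv a =
      (Module.AEval'.of (shiftP p m - 1)).toAddEquiv (shiftP p m a) := by
  rw [map_neg, map_one, sub_neg_eq_add, add_smul, one_smul]
  refine (congrArg (· + _) (Module.AEval'.X_smul_of (shiftP p m - 1) a)).trans ?_
  rw [LinearMap.sub_apply, Module.End.one_apply, map_sub]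
  exact sub_add_cancel _ _

theorem smul_pShift' (p m : ℕ) [Fact p.Prime] (h2 : p ≠ 2) (a : PGroup p m) :
    algebraMap ℤ[X] R₂ (X + 1) • PShift'.of p m h2 a = PShift'.of p m h2 (shiftP p m a) := by
  rw [← AddEquiv.symm_apply_eq, PShift'.algebraMap_smul]
  have := X_sub_C_smul_pShift p m a
  rw [map_neg, map_one, sub_neg_eq_add] at this
  exact (LinearEquiv.symm_apply_eq _).2 this

/-! ### The socle series of an `m`-power torsion module -/

section SocleSeries

variable {R M : Type*} [CommRing R] [AddCommGroup M] [Module R M] {m : Ideal R}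

theorem mem_socle_iff (hmax : m.IsMaximal) (hM : ∀ a : M, ∃ k, ∀ r ∈ m ^ k, r • a = 0) {a : M} :
    a ∈ socle R M ↔ ∀ r ∈ m, r • a = 0 := by
  constructor
  · have hle : socle R M ≤ Submodule.torsionBySet R M m := by
      refine sSup_le fun N hN => ?_
      have hat : IsAtom N := isSimpleModule_iff_isAtom.1 hN
      have h0 : m • N = ⊥ := by
        -- If `m N = N`, then `m ^ k N = N` for all `k`, although `N` is generated by one element
        -- killed by some `m ^ k`.
        refine (hat.le_iff.1 (Submodule.smul_le_right : m • N ≤ N)).resolve_right fun hmN => ?_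
        obtain ⟨t, ht, ht0⟩ := Submodule.exists_mem_ne_zero_of_ne_bot hat.1
        obtain ⟨k, hk⟩ := hM t
        have hpow : ∀ j, m ^ j • N = N := by
          intro j
          induction j with
          | zero => simp
          | succ j ih => rw [pow_succ, Submodule.mul_smul, hmN, ih]
        have hspan : Submodule.span R {t} = N :=
          (hat.le_iff.1 ((Submodule.span_singleton_le_iff_mem _ _).2 ht)).resolve_left
            (by simpa using ht0)
        refine hat.1 ?_
        rw [← hpow k, eq_bot_iff, Submodule.smul_le]
        intro r hr x hx
        rw [← hspan] at hx
        obtain ⟨s, rfl⟩ := Submodule.mem_span_singleton.1 hx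
        rw [smul_comm, hk r hr, smul_zero]
        exact zero_mem _
      intro x hx
      refine (Submodule.mem_torsionBySet_iff _ _).2 fun r => ?_
      exact (Submodule.mem_bot R).1 (h0 ▸ Submodule.smul_mem_smul r.2 hx)
    exact fun ha r hr => (Submodule.mem_torsionBySet_iff _ _).1 (hle ha) ⟨r, hr⟩
  · intro ha
    by_cases ha0 : a = 0
    · exact ha0 ▸ zero_mem _
    have hat : IsAtom (Submodule.span R {a}) := by
      refine ⟨by simpa using ha0, fun L hL => ?_⟩
      by_contra hL0
      obtain ⟨x, hx, hx0⟩ := Submodule.exists_mem_ne_zero_of_ne_bot hL0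
      obtain ⟨r, rfl⟩ := Submodule.mem_span_singleton.1 (hL.le hx)
      have hr : r ∉ m := fun hr => hx0 (ha r hr)
      obtain ⟨s, i, hi, hsi⟩ := hmax.exists_inv hr
      have : s • r • a = a := by
        rw [smul_smul, ← add_zero ((s * r) • a), ← ha i hi, ← add_smul, hsi, one_smul]
      exact absurd ((Submodule.span_singleton_le_iff_mem _ _).2 (this ▸ L.smul_mem s hx))
        (not_le_of_gt hL)
    exact (le_sSup (isSimpleModule_iff_isAtom.2 hat) : _ ≤ socle R M)
      (Submodule.mem_span_singleton_self a)

theorem mem_socleSeries_iff (hmax : m.IsMaximal)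
    (hM : ∀ a : M, ∃ k, ∀ r ∈ m ^ k, r • a = 0) (j : ℕ) (a : M) :
    a ∈ socleSeries R M j ↔ ∀ r ∈ m ^ j, r • a = 0 := by
  induction j generalizing a with
  | zero =>
    simp only [socleSeries, Submodule.mem_bot, pow_zero, Ideal.one_eq_top]
    exact ⟨fun h r _ => by rw [h, smul_zero], fun h => by simpa using h 1 trivial⟩
  | succ j ih =>
    rw [socleSeries, Submodule.mem_comap, mem_socle_iff hmax]
    · have h1 : ∀ r : R, r • (socleSeries R M j).mkQ a = 0 ↔ ∀ s ∈ m ^ j, s • r • a = 0 := by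
        intro r
        rw [← map_smul, Submodule.mkQ_apply, Submodule.Quotient.mk_eq_zero, ih]
      simp only [h1]
      rw [pow_succ]
      constructor
      · intro h t ht
        have hle : m ^ j * m ≤ LinearMap.ker (LinearMap.toSpanSingleton R M a) :=
          Ideal.mul_le.2 fun s hs r hr => by
            rw [LinearMap.mem_ker, LinearMap.toSpanSingleton_apply, mul_smul]
            exact h r hr s hs
        exact hle ht
      · intro h r hr s hs
        rw [smul_smul]
        exact h _ (Ideal.mul_mem_mul hs hr)
    · intro x
      obtain ⟨b, rfl⟩ := Submodule.mkQ_surjective _ x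
      obtain ⟨k, hk⟩ := hM b
      exact ⟨k, fun r hr => by rw [← map_smul, hk r hr, map_zero]⟩

end SocleSeries

/-! ### The embedding of `P_m` into the divided power module -/

section Quasicyclic

variable (p : ℕ) [hp : Fact p.Prime]

theorem zsmul_one_div_pow_eq_zero_iff {k : ℕ} {z : ℤ} :
    z • ((1 / (p : ℚ) ^ k : ℚ) : AddCircle (1 : ℚ)) = 0 ↔ (p : ℤ) ^ k ∣ z := by
  have hp0 : (p : ℚ) ^ k ≠ 0 := pow_ne_zero _ (by exact_mod_cast hp.out.ne_zero)
  rw [← AddCircle.coe_zsmul, AddCircle.coe_eq_zero_iff]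
  simp only [zsmul_eq_mul, mul_one]
  refine exists_congr fun n => ?_
  rw [← mul_div_assoc, mul_one, eq_div_iff hp0]
  constructor
  · intro h
    have : n * (p : ℤ) ^ k = z := by exact_mod_cast h
    rw [← this, mul_comm]
  · rintro rfl
    push_cast
    ring

/-- The class of `1 / p ^ k` in `ℤ_{p^∞}`. -/
def quasicyclicGen (k : ℕ) : Quasicyclic p :=
  ⟨((1 / (p : ℚ) ^ k : ℚ) : AddCircle (1 : ℚ)), k, by
    have := (zsmul_one_div_pow_eq_zero_iff p (k := k) (z := (p : ℤ) ^ k)).2 dvd_rfl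
    rwa [← Nat.cast_pow, natCast_zsmul] at this⟩

variable {p}

theorem zsmul_quasicyclicGen_eq_zero {k : ℕ} {z : ℤ} :
    z • quasicyclicGen p k = 0 ↔ (p : ℤ) ^ k ∣ z := by
  rw [← zsmul_one_div_pow_eq_zero_iff p]
  exact Subtype.ext_iff

theorem zsmul_quasicyclicGen_succ (k : ℕ) :
    (p : ℤ) • quasicyclicGen p (k + 1) = quasicyclicGen p k := by
  have hp0 : (p : ℚ) ≠ 0 := by exact_mod_cast hp.out.ne_zero
  refine Subtype.ext ?_
  change (p : ℤ) • ((1 / (p : ℚ) ^ (k + 1) : ℚ) : AddCircle (1 : ℚ)) =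
    ((1 / (p : ℚ) ^ k : ℚ) : AddCircle (1 : ℚ))
  rw [← AddCircle.coe_zsmul]
  congr 1
  rw [zsmul_eq_mul, pow_succ]
  push_cast
  field_simp

theorem exists_zsmul_quasicyclicGen {k : ℕ} {x : Quasicyclic p} (hx : (p : ℤ) ^ k • x = 0) :
    ∃ z : ℤ, z • quasicyclicGen p k = x := by
  have hp0 : (p : ℚ) ^ k ≠ 0 := pow_ne_zero _ (by exact_mod_cast hp.out.ne_zero)
  obtain ⟨x, hmem⟩ := x
  obtain ⟨q, rfl⟩ := QuotientAddGroup.mk_surjective x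
  have h1 : (p : ℤ) ^ k • (q : AddCircle (1 : ℚ)) = 0 := congrArg Subtype.val hx
  rw [← AddCircle.coe_zsmul, AddCircle.coe_eq_zero_iff] at h1
  obtain ⟨z, hz⟩ := h1
  refine ⟨z, Subtype.ext ?_⟩
  change z • ((1 / (p : ℚ) ^ k : ℚ) : AddCircle (1 : ℚ)) = (q : AddCircle (1 : ℚ))
  rw [← AddCircle.coe_zsmul]
  congr 1
  simp only [zsmul_eq_mul, mul_one, Int.cast_pow, Int.cast_natCast] at hz ⊢
  rw [hz]
  field_simp

theorem exists_pow_zsmul_eq_zero (x : Quasicyclic p) : ∃ k : ℕ, (p : ℤ) ^ k • x = 0 := by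
  obtain ⟨x, k, hk⟩ := x
  refine ⟨k, Subtype.ext ?_⟩
  rw [← Nat.cast_pow, natCast_zsmul]
  exact hk

variable (p)

/-- The embedding of `ℤ_{p^k}` into `ℤ_{p^∞}`. -/
def quasicyclicHom (k : ℕ) : ZMod (p ^ k) →+ Quasicyclic p :=
  ZMod.lift (p ^ k) ⟨zmultiplesHom (Quasicyclic p) (quasicyclicGen p k), by
    rw [zmultiplesHom_apply, zsmul_quasicyclicGen_eq_zero, Nat.cast_pow]⟩

theorem quasicyclicHom_intCast (k : ℕ) (z : ℤ) :
    quasicyclicHom p k z = z • quasicyclicGen p k := by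
  simp [quasicyclicHom]

/-- The homomorphism `a ↦ (a(0) / p ^ m, a(1) / p ^ (m - 1), …)`. -/
noncomputable def toDividedPower (m : ℕ) : PGroup p m →+ (ℕ →₀ Quasicyclic p) :=
  ∑ n : Fin m, (Finsupp.singleAddHom (n : ℕ)).comp
    ((quasicyclicHom p (m - n)).comp (Pi.evalAddMonoidHom _ n))

variable {p}

theorem toDividedPower_intVec_apply {m : ℕ} (z : Fin m → ℤ) (k : ℕ) :
    toDividedPower p m (intVec p m z) k =
      if h : k < m then z ⟨k, h⟩ • quasicyclicGen p (m - k) else 0 := by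
  simp only [toDividedPower, AddMonoidHom.finsetSum_apply, Finsupp.finsetSum_apply,
    AddMonoidHom.comp_apply, Finsupp.singleAddHom_apply, Pi.evalAddMonoidHom_apply, intVec,
    quasicyclicHom_intCast, Finsupp.single_apply]
  split_ifs with h
  · rw [Finset.sum_eq_single ⟨k, h⟩]
    · simp
    · intro n _ hn
      rw [if_neg fun hk => hn (Fin.ext hk)]
    · simp
  · refine Finset.sum_eq_zero fun n _ => if_neg ?_
    have := n.2
    omega

/-- The factor `p` in the action on `P_m` compensates the change of denominator from `p ^ (m - k)`
to `p ^ (m - (k + 1))`, leaving the plain shift. -/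
theorem toDividedPower_shiftP {m : ℕ} (a : PGroup p m) (k : ℕ) :
    toDividedPower p m (shiftP p m a) k = toDividedPower p m a (k + 1) := by
  obtain ⟨z, rfl⟩ := intVec_surjective p m a
  rw [shiftP_intVec, zsmul_intVec, toDividedPower_intVec_apply, toDividedPower_intVec_apply]
  by_cases h : k + 1 < m
  · rw [dif_pos h, dif_pos (by omega)]
    rw [show m - k = m - (k + 1) + 1 by omega, Pi.smul_apply, smul_eq_mul, mul_comm, mul_smul,
      zsmul_quasicyclicGen_succ]
    simp [shiftInt, h]
  · rw [dif_neg h]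
    split_ifs
    · simp [shiftInt, h]
    · rfl

theorem toDividedPower_injective (m : ℕ) : Function.Injective (toDividedPower p m) := by
  rw [injective_iff_map_eq_zero]
  intro a ha
  obtain ⟨z, rfl⟩ := intVec_surjective p m a
  rw [← intVec_zero, eq_comm, intVec_eq_iff]
  intro n
  have h := DFunLike.congr_fun ha (n : ℕ)
  rw [toDividedPower_intVec_apply, dif_pos n.2, Finsupp.zero_apply,
    zsmul_quasicyclicGen_eq_zero] at h
  simpa using h

theorem exists_toDividedPower_eq {m : ℕ} {f : ℕ →₀ Quasicyclic p} (h0 : ∀ k, m ≤ k → f k = 0)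
    (h1 : ∀ k < m, (p : ℤ) ^ (m - k) • f k = 0) : ∃ a, toDividedPower p m a = f := by
  choose z hz using fun n : Fin m => exists_zsmul_quasicyclicGen (h1 n n.2)
  refine ⟨intVec p m z, Finsupp.ext fun k => ?_⟩
  rw [toDividedPower_intVec_apply]
  split_ifs with h
  · exact hz ⟨k, h⟩
  · exact (h0 k (not_lt.1 h)).symm

theorem DividedPowerModule.monomial_smul_apply {M : Type*} [AddCommGroup M]
    (j : ℕ) (c : ℤ) (a : ℕ →₀ M) (n : ℕ) :
    (Module.AEval'.of (Finsupp.lcomapDomain Nat.succ Nat.succ_injective :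
        (ℕ →₀ M) →ₗ[ℤ] (ℕ →₀ M))).symm
      (monomial j c • Module.AEval'.of (Finsupp.lcomapDomain Nat.succ Nat.succ_injective :
        (ℕ →₀ M) →ₗ[ℤ] (ℕ →₀ M)) a) n = c • a (n + j) := by
  rw [DividedPowerModule.smul_apply, sum_monomial_index _ _ (by simp)]

theorem monomial_mem_span_pow (p i j : ℕ) :
    monomial j ((p : ℤ) ^ i) ∈ Ideal.span {(p : ℤ[X]), X - C 0} ^ (i + j) := by
  have h : monomial j ((p : ℤ) ^ i) = (p : ℤ[X]) ^ i * (X - C 0) ^ j := by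
    rw [← C_mul_X_pow_eq_monomial]
    simp
  rw [h, pow_add]
  exact Ideal.mul_mem_mul (Ideal.pow_mem_pow (Ideal.subset_span (by simp)) i)
    (Ideal.pow_mem_pow (Ideal.subset_span (by simp)) j)

/-- A power of `p` kills the finitely many nonzero coordinates, and a power of `x` shifts past the
support. As the ideal is finitely generated, one of its powers kills the element. -/
theorem DividedPowerModule.exists_pow_smul_eq_zero
    (x : DividedPowerModule ℤ (Quasicyclic p)) :
    ∃ k, ∀ r ∈ Ideal.span {(p : ℤ[X]), X - C 0} ^ k, r • x = 0 := by
  obtain ⟨f, rfl⟩ := (Module.AEval'.of (Finsupp.lcomapDomain Nat.succ Nat.succ_injective :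
        (ℕ →₀ Quasicyclic p) →ₗ[ℤ] (ℕ →₀ Quasicyclic p))).surjective x
  set e := Module.AEval'.of (Finsupp.lcomapDomain Nat.succ Nat.succ_injective :
        (ℕ →₀ Quasicyclic p) →ₗ[ℤ] (ℕ →₀ Quasicyclic p)) with he
  suffices h : ∃ k, Ideal.span {(p : ℤ[X]), X - C 0} ^ k ≤
      LinearMap.ker (LinearMap.toSpanSingleton ℤ[X] _ (e f)) by
    obtain ⟨k, hk⟩ := h
    exact ⟨k, fun r hr => hk hr⟩
  refine Ideal.exists_pow_le_of_le_radical_of_fg ?_ (Submodule.fg_span (Set.toFinite _))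
  rw [Ideal.span_le, Set.insert_subset_iff, Set.singleton_subset_iff]
  constructor
  · choose k hk using fun n => exists_pow_zsmul_eq_zero (f n)
    refine ⟨f.support.sup k, ?_⟩
    rw [LinearMap.mem_ker, LinearMap.toSpanSingleton_apply, ← e.symm.map_eq_zero_iff]
    have hc : (p : ℤ[X]) ^ f.support.sup k = monomial 0 ((p : ℤ) ^ f.support.sup k) := by simp
    rw [hc]
    refine Finsupp.ext fun n => ?_
    rw [DividedPowerModule.monomial_smul_apply, add_zero, Finsupp.zero_apply]
    by_cases hn : n ∈ f.support
    · rw [← Nat.sub_add_cancel (Finset.le_sup (f := k) hn), pow_add, mul_smul, hk, smul_zero]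
    · rw [Finsupp.notMem_support_iff.1 hn, smul_zero]
  · refine ⟨f.support.sup id + 1, ?_⟩
    rw [LinearMap.mem_ker, LinearMap.toSpanSingleton_apply, ← e.symm.map_eq_zero_iff]
    have hc : (X - C 0 : ℤ[X]) ^ (f.support.sup id + 1) =
        monomial (f.support.sup id + 1) (1 : ℤ) := by
      rw [map_zero, sub_zero, monomial_one_right_eq_X_pow]
    rw [hc]
    refine Finsupp.ext fun n => ?_
    rw [DividedPowerModule.monomial_smul_apply, one_smul, Finsupp.zero_apply]
    by_contra hn
    have := Finset.le_sup (f := id) (Finsupp.mem_support_iff.2 hn)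
    simp only [id] at this
    omega

/-- The isomorphism `P_m ≃ S_m(N)`. -/
theorem nonempty_pMod_equiv_socleSeries (p m : ℕ) [hp : Fact p.Prime]
    (hmax : (Ideal.span {(p : ℤ[X]), X - C 0}).IsMaximal) :
    Nonempty (PMod p m ≃ₗ[ℤ[X]] socleSeries ℤ[X] (DividedPowerModule ℤ (Quasicyclic p)) m) := by
  set e := Module.AEval'.of (Finsupp.lcomapDomain Nat.succ Nat.succ_injective :
        (ℕ →₀ Quasicyclic p) →ₗ[ℤ] (ℕ →₀ Quasicyclic p)) with he
  let F : PMod p m →ₗ[ℤ[X]] DividedPowerModule ℤ (Quasicyclic p) :=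
    LinearMap.ofAEval _ (e.toLinearMap ∘ₗ (toDividedPower p m).toIntLinearMap) fun a => by
      have h : toDividedPower p m (shiftP p m a) =
          (Finsupp.lcomapDomain Nat.succ Nat.succ_injective :
            (ℕ →₀ Quasicyclic p) →ₗ[ℤ] (ℕ →₀ Quasicyclic p)) (toDividedPower p m a) :=
        Finsupp.ext fun k => (toDividedPower_shiftP a k).trans (by
          simp [Finsupp.lcomapDomain, Finsupp.comapDomain_apply])
      exact (congrArg e h).trans (Module.AEval'.X_smul_of _ _).symm
  have hF : ∀ a, F (Module.AEval'.of (shiftP p m) a) = e (toDividedPower p m a) := fun a => rfl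
  have hinj : Function.Injective F := by
    intro x y hxy
    obtain ⟨a, rfl⟩ := (Module.AEval'.of (shiftP p m)).surjective x
    obtain ⟨b, rfl⟩ := (Module.AEval'.of (shiftP p m)).surjective y
    rw [hF, hF] at hxy
    rw [toDividedPower_injective m (e.injective hxy)]
  have hrange : LinearMap.range F =
      socleSeries ℤ[X] (DividedPowerModule ℤ (Quasicyclic p)) m := by
    ext x
    rw [mem_socleSeries_iff hmax DividedPowerModule.exists_pow_smul_eq_zero]
    constructor
    · rintro ⟨y, rfl⟩ r hr
      have := pow_le_annihilator_of_shiftP _ (X_sub_C_smul_pMod p m) hr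
      rw [← map_smul, Module.mem_annihilator.1 this, map_zero]
    · intro hx
      obtain ⟨f, rfl⟩ := e.surjective x
      -- Testing on the monomials `p ^ i * x ^ j` suffices: `i = 0`, `j = k` gives vanishing from
      -- position `m` on, and `i = m - k`, `j = k` bounds the order of the coordinate at `k`.
      have hmon : ∀ i j, m ≤ i + j → ∀ n, (p : ℤ) ^ i • f (n + j) = 0 := by
        intro i j hij n
        have h := DividedPowerModule.monomial_smul_apply j ((p : ℤ) ^ i) f n
        rw [← he, hx _ (Ideal.pow_le_pow_right hij (monomial_mem_span_pow p i j)), map_zero] at h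
        exact h.symm
      obtain ⟨a, rfl⟩ := exists_toDividedPower_eq (m := m) (f := f)
        (fun k hk => by simpa using hmon 0 k (by omega) 0)
        (fun k hk => by simpa using hmon (m - k) k (by omega) 0)
      exact ⟨_, hF a⟩
  exact ⟨(LinearEquiv.ofInjective F hinj).trans (LinearEquiv.ofEq _ _ hrange)⟩

end Quasicyclic

/-! ### The three cases -/

theorem mainTheorem7 (p : ℕ) [Fact p.Prime] :
    (∀ (Q : Type*) [AddCommGroup Q] [Module ℤ[X] Q],
      IsCocyclic ℤ[X] Q →
      Nonempty (socle ℤ[X] Q ≃ₗ[ℤ[X]] PMod p 1) →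
      Nat.card Q = p ^ 6 →
      (∃ s : Finset Q, s.card ≤ 3 ∧ Submodule.span ℤ[X] (s : Set Q) = ⊤) ∧
      ((⊤ : Submodule ℤ[X] Q).spanFinrank = 3 →
        Nonempty (Q ≃ₗ[ℤ[X]] PMod p 3) ∧
        Nonempty (PMod p 3 ≃ₗ[ℤ[X]]
          socleSeries ℤ[X] (DividedPowerModule ℤ (Quasicyclic p)) 3))) ∧
    (∀ (Q : Type*) [AddCommGroup Q] [Module ℤ[X] Q],
      IsCocyclic ℤ[X] Q →
      Nonempty (socle ℤ[X] Q ≃ₗ[ℤ[X]] PShift p 1) →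
      Nat.card Q = p ^ 6 →
      (∃ s : Finset Q, s.card ≤ 3 ∧ Submodule.span ℤ[X] (s : Set Q) = ⊤) ∧
      ((⊤ : Submodule ℤ[X] Q).spanFinrank = 3 → Nonempty (Q ≃ₗ[ℤ[X]] PShift p 3))) ∧
    (∀ (h2 : p ≠ 2) (Q : Type*) [AddCommGroup Q] [Module R₂ Q],
      IsCocyclic R₂ Q →
      Nonempty (socle R₂ Q ≃ₗ[R₂] PShift' p 1 h2) →
      Nat.card Q = p ^ 6 →
      (∃ s : Finset Q, s.card ≤ 3 ∧ Submodule.span R₂ (s : Set Q) = ⊤) ∧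
      ((⊤ : Submodule R₂ Q).spanFinrank = 3 → Nonempty (Q ≃ₗ[R₂] PShift' p 3 h2))) := by
  have hp : Fact p.Prime := inferInstance
  refine ⟨fun Q _ _ hQ ⟨f⟩ hcard => ?_, fun Q _ _ hQ ⟨f⟩ hcard => ?_,
    fun h2 Q _ _ hQ ⟨f⟩ hcard => ?_⟩
  · have h := hQ.generators_and_linearEquiv (hasPrimeResidue_polynomial hp.out 0
      (span_ne_top_of_shiftP _ (X_sub_C_smul_pMod p 1))) rfl
      (smul_socle_eq_zero _ (X_sub_C_smul_pMod p 1) f) hcard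
      (IsCocyclic.of_shiftP _ (X_sub_C_smul_pMod p 3))
      ((Nat.card_congr (Module.AEval'.of (shiftP p 3)).symm.toEquiv).trans (natCard_pGroup_three p))
      (pow_le_annihilator_of_shiftP _ (X_sub_C_smul_pMod p 3))
    exact ⟨h.1, fun h3 => ⟨h.2 h3, nonempty_pMod_equiv_socleSeries p 3
      (hasPrimeResidue_polynomial hp.out 0
        (span_ne_top_of_shiftP _ (X_sub_C_smul_pMod p 1))).isMaximal⟩⟩
  · exact hQ.generators_and_linearEquiv (hasPrimeResidue_polynomial hp.out (-1)
      (span_ne_top_of_shiftP _ (X_sub_C_smul_pShift p 1))) rfl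
      (smul_socle_eq_zero _ (X_sub_C_smul_pShift p 1) f) hcard
      (IsCocyclic.of_shiftP _ (X_sub_C_smul_pShift p 3))
      ((Nat.card_congr (Module.AEval'.of (shiftP p 3 - 1)).symm.toEquiv).trans
        (natCard_pGroup_three p))
      (pow_le_annihilator_of_shiftP _ (X_sub_C_smul_pShift p 3))
  · exact hQ.generators_and_linearEquiv (hasPrimeResidue_R₂ hp.out h2
      (span_ne_top_of_shiftP _ (smul_pShift' p 1 h2))) rfl
      (smul_socle_eq_zero _ (smul_pShift' p 1 h2) f) hcard
      (IsCocyclic.of_shiftP _ (smul_pShift' p 3 h2))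
      ((Nat.card_congr (PShift'.of p 3 h2).symm.toEquiv).trans (natCard_pGroup_three p))
      (pow_le_annihilator_of_shiftP _ (smul_pShift' p 3 h2))
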